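/- Let $n\ge 1$. Let $\psi:\mathbb R^n\to\mathbb R$ be a smooth cut-off function supported in $\{|\xi|\le 2\}$ and equal to $1$ near the origin. Put $\varphi=\psi(\cdot)-\psi(2\,\cdot)$, $\varphi_k(\xi)=\varphi(2^{-k}\xi)$ and $\Delta_k=\mathcal F^{-1}\varphi_k\mathcal F$ for $k\in\mathbb Z$. For $s\in\mathbb R$ and $0<p,q\le\infty$ let $$\|u\|_{\dot B^s_{p,q}}=\Big(\sum_{k\in\mathbb Z}2^{ksq}\,\|\Delta_k u\|_{L^p(\mathbb R^n)}^q\Big)^{1/q}$$ (with the supremum over $k$ if $q=\infty$), and let $\dot B^s_{p,q}$ be the space of tempered distributions $u$, modulo polynomials, for which this quantity is finite. We use the conventions $1/\infty=0$ and $0^0=1$. **Theorem 1.2.** Let $0<p,p_0,p_1,q,q_0,q_1\le\infty$, $s,s_0,s_1\in\mathbb R$ and $0\le\theta\le1$. There is a constant $C$ (independent of $u$) such that $$\|u\|_{\dot B^s_{p,q}}\le C\,\|u\|_{\dot B^{s_0}_{p_0,q_0}}^{1-\theta}\,\|u\|_{\dot B^{s_1}_{p_1,q_1}}^{\theta}\qquad\text{for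 all }u\in\dot B^{s_0}_{p_0,q_0}\cap\dot B^{s_1}_{p_1,q_1}$$ if and only if all of the following conditions hold: $$\frac np-s=(1-\theta)\Big(\frac n{p_0}-s_0\Big)+\theta\Big(\frac n{p_1}-s_1\Big);$$ $$s\le(1-\theta)s_0+\theta s_1;$$ if $p_0\ne p_1$ and $s=(1-\theta)s_0+\theta s_1$, then $$\frac1q\le\frac{1-\theta}{q_0}+\frac{\theta}{q_1};$$ if $p_0=p_1$ and $s=(1-\theta)s_0+\theta s_1$, then $$\big(0<\theta<1\ \text{ and }\ s_0\ne s_1\big)\quad\text{or}\quad\frac1q\le\frac{1-\theta}{q_0}+\frac{\theta}{q_1};$$ if $s<(1-\theta)s_0+\theta s_1$, then $$\Big(0<\theta<1\ \text{ and }\ s_0-\frac n{p_0}\ne s-\frac np\Big)\quad\text{or}\quad\frac1q\le\frac{1-\theta}{q_0}+\frac{\theta}{q_1}.$$ -/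

import Mathlib

open MeasureTheory
open scoped ENNReal NNReal SchwartzMap ContDiff

noncomputable section

namespace HomBesov

/-- A smooth cut-off function on `ℝⁿ`: smooth, supported in the ball `{ξ : |ξ| ≤ 2}`, and equal
to `1` in a neighbourhood of the origin. -/
structure IsCutoff {n : ℕ} (ψ : EuclideanSpace ℝ (Fin n) → ℝ) : Prop where
  smooth : ContDiff ℝ ∞ ψ
  support : tsupport ψ ⊆ Metric.closedBall 0 2
  eq_one : ∀ᶠ ξ in nhds (0 : EuclideanSpace ℝ (Fin n)), ψ ξ = 1

/-- The dyadic function `φ_k(ξ) = φ(2^{-k} ξ)`, where `φ = ψ(·) - ψ(2 ·)`. -/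
def dyadic {n : ℕ} (ψ : EuclideanSpace ℝ (Fin n) → ℝ) (k : ℤ) (ξ : EuclideanSpace ℝ (Fin n)) : ℝ :=
  ψ (((2 : ℝ) ^ (-k)) • ξ) - ψ ((2 : ℝ) • (((2 : ℝ) ^ (-k)) • ξ))

/-- The homogeneous dyadic decomposition operator `Δ_k = 𝓕⁻¹ φ_k 𝓕` on tempered distributions. -/
def block {n : ℕ} (ψ : EuclideanSpace ℝ (Fin n) → ℝ) (k : ℤ)
    (u : 𝓢'(EuclideanSpace ℝ (Fin n), ℂ)) : 𝓢'(EuclideanSpace ℝ (Fin n), ℂ) :=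
  TemperedDistribution.fourierMultiplierCLM ℂ (fun ξ => (dyadic ψ k ξ : ℂ)) u

/-- The tempered distribution `T` is (integration against) the function `g`. -/
def IsRepresentedBy {n : ℕ} (T : 𝓢'(EuclideanSpace ℝ (Fin n), ℂ))
    (g : EuclideanSpace ℝ (Fin n) → ℂ) : Prop :=
  ∀ f : 𝓢(EuclideanSpace ℝ (Fin n), ℂ),
    Integrable (fun x => f x * g x) ∧ T f = ∫ x, f x * g x

/-- The `L^p` (quasi-)norm, `0 < p ≤ ∞`, of a tempered distribution: the `L^p` (quasi-)norm of the
function that represents it (this function is unique up to null sets, so the infimum is over a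
single value), and `∞` if the distribution is not a function. -/
def distLpNorm {n : ℕ} (p : ℝ≥0∞) (T : 𝓢'(EuclideanSpace ℝ (Fin n), ℂ)) : ℝ≥0∞ :=
  ⨅ (g : EuclideanSpace ℝ (Fin n) → ℂ) (_ : IsRepresentedBy T g), eLpNorm g p volume

/-- The `ℓ^q(ℤ)` (quasi-)norm, `0 < q ≤ ∞`, of a two-sided sequence in `[0, ∞]`. -/
def seqNorm (q : ℝ≥0∞) (a : ℤ → ℝ≥0∞) : ℝ≥0∞ :=
  if q = ⊤ then ⨆ k, a k else (∑' k, a k ^ q.toReal) ^ (1 / q.toReal)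

/-- The homogeneous Besov (quasi-)norm `(∑_k 2^{ksq} ‖Δ_k u‖_p^q)^{1/q}` (supremum if `q = ∞`).
It depends only on the class of `u` modulo polynomials. -/
def besovNorm {n : ℕ} (ψ : EuclideanSpace ℝ (Fin n) → ℝ) (s : ℝ) (p q : ℝ≥0∞)
    (u : 𝓢'(EuclideanSpace ℝ (Fin n), ℂ)) : ℝ≥0∞ :=
  seqNorm q fun k : ℤ => (2 : ℝ≥0∞) ^ ((k : ℝ) * s) * distLpNorm p (block ψ k u)

/-- The tempered distributions whose class modulo polynomials lies in the homogeneous Besov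
space, i.e. those with finite homogeneous Besov (quasi-)norm. -/
def besovSpace {n : ℕ} (ψ : EuclideanSpace ℝ (Fin n) → ℝ) (s : ℝ) (p q : ℝ≥0∞) :
    Set 𝓢'(EuclideanSpace ℝ (Fin n), ℂ) :=
  {u | besovNorm ψ s p q u < ⊤}

/-- The real number `1/p` for `0 < p ≤ ∞`, with `1/∞ = 0`. -/
def recip (p : ℝ≥0∞) : ℝ := (p⁻¹).toReal

end HomBesov

end

namespace HomBesov

/-! Sufficiency. Each block `Δ_k u` has spectrum in a ball of radius comparable to `2^k`. For `τ ∈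
[0,1]` let `1/r = (1-τ)/p₀ + τ/p₁`. Hölder bounds the `L^r` norm of the block by its `L^{p₀}` and
`L^{p₁}` norms, and, when `r ≤ p`, Nikolskii's inequality passes from `L^r` to `L^p` at the cost of
a power of `2^k` (`exists_block_le`). The scaling identity turns `s ≤ (1-θ)s₀ + θs₁` into `r ≤ p` at
`τ = θ`, and makes the power of `2^k` vanish there. Hölder for sequences then gives the inequality
if `1/q ≤ (1-θ)/q₀ + θ/q₁`. If this fails, one uses `τ = θ ± δ` instead: when the two spaces have
different homogeneity, the powers of `2^k` are two opposite geometric progressions, the weighted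
blocks decay away from the crossing point, and the sum converges for every `q`
(`exists_besovNorm_le_of_ne`).

Necessity. A packet at frequency `2^k` with amplitude `2^α` and spatial width `2^{-β}`, `β ≤ k`, has
weighted block norm about `2^{ks + α - βn/p}`. Packets at well-separated frequencies do not
interact, so if these exponents all equal `e` on a set `S`, the Besov norm is about `2^e |S|^{1/q}`
(`exists_testFunctions`). Taking logarithms turns the inequality into a linear one between exponents
(`exists_exponent_le`). One packet with `β = k → ±∞` forces the scaling identity; one packet at `k =
0` with `β → -∞` forces `s ≤ (1-θ)s₀ + θs₁`. Whenever arbitrarily many packets can be balanced in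
all the norms that count, `|S| → ∞` forces the condition on `q` (`recip_le_of_balanced`). -/

lemma recip_nonneg (p : ℝ≥0∞) : 0 ≤ recip p := ENNReal.toReal_nonneg

@[simp] lemma recip_top : recip ⊤ = 0 := by simp [recip]

lemma recip_eq (p : ℝ≥0∞) : recip p = 1 / p.toReal := by simp [recip]

lemma recip_pos {p : ℝ≥0∞} (hp : 0 < p) (h : p ≠ ⊤) : 0 < recip p := by
  rw [recip_eq]; have := ENNReal.toReal_pos hp.ne' h; positivity

lemma recip_injective {p q : ℝ≥0∞} (hp : 0 < p) (hq : 0 < q) (h : recip p = recip q) : p = q := by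
  have := (ENNReal.toReal_eq_toReal_iff' (ENNReal.inv_ne_top.2 hp.ne')
    (ENNReal.inv_ne_top.2 hq.ne')).1 h
  simpa using this

lemma exists_recip_eq {t : ℝ} (ht : 0 ≤ t) : ∃ p : ℝ≥0∞, 0 < p ∧ recip p = t :=
  ⟨(ENNReal.ofReal t)⁻¹, by simp, by simp [recip, ht]⟩

/-! ### Hölder's inequality for exponents in `(0, ∞]`. -/

section Interpolation

variable {α : Type*} [MeasurableSpace α] {μ : Measure α} {f f₀ f₁ : α → ℝ≥0∞}

/-- With `p₀ = ∞` the factor `f₀` is bounded by its essential supremum and leaves the integral. The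
case `p = ∞` arises either from `p₁ = ∞` or from `θ = 0`, when `f₁ ^ θ = 1`. -/
lemma eLpNorm_le_of_recip_eq_of_top (hf₁ : AEMeasurable f₁ μ) {p p₁ : ℝ≥0∞}
    (hp : 0 < p) (hp₁ : 0 < p₁) {θ : ℝ} (hθ₀ : 0 ≤ θ) (hθ₁ : θ ≤ 1)
    (h : recip p = θ * recip p₁) (hle : ∀ᵐ x ∂μ, f x ≤ f₀ x ^ (1 - θ) * f₁ x ^ θ) :
    eLpNorm f p μ ≤ eLpNorm f₀ ⊤ μ ^ (1 - θ) * eLpNorm f₁ p₁ μ ^ θ := by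
  have h0 : ∀ᵐ x ∂μ, f₀ x ≤ eLpNorm f₀ ⊤ μ := by
    rw [eLpNorm_exponent_top]
    filter_upwards [ae_le_eLpNormEssSup (f := f₀) (μ := μ)] with x hx using by simpa using hx
  by_cases ht : p = ⊤
  · subst ht
    have : ∀ᵐ x ∂μ, f₁ x ^ θ ≤ eLpNorm f₁ p₁ μ ^ θ := by
      rcases hθ₀.eq_or_lt with rfl | hθ
      · simp
      · have : p₁ = ⊤ := by
          by_contra h1
          have := mul_pos hθ (recip_pos hp₁ h1)
          simp at h; rcases h with h | h <;> simp [h] at this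
        subst this
        rw [eLpNorm_exponent_top]
        filter_upwards [ae_le_eLpNormEssSup (f := f₁) (μ := μ)] with x hx
        exact ENNReal.rpow_le_rpow (by simpa using hx) hθ₀
    rw [eLpNorm_exponent_top (f := f)]
    refine eLpNormEssSup_le_of_ae_enorm_bound ?_
    filter_upwards [h0, this, hle] with x hx hx' hx''
    exact hx''.trans (mul_le_mul' (ENNReal.rpow_le_rpow hx (by linarith)) hx')
  have hr := recip_pos hp ht
  have hθ : 0 < θ := by
    rcases hθ₀.eq_or_lt with rfl | hθ
    · simp [h] at hr
    · exact hθ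
  have ht₁ : p₁ ≠ ⊤ := by rintro rfl; simp [h] at hr
  have hP := ENNReal.toReal_pos hp.ne' ht
  have hP₁ := ENNReal.toReal_pos hp₁.ne' ht₁
  rw [recip_eq, recip_eq] at h
  have hθp : θ * p.toReal = p₁.toReal := by field_simp at h; linarith
  rw [eLpNorm_eq_lintegral_rpow_enorm_toReal hp.ne' ht,
    eLpNorm_eq_lintegral_rpow_enorm_toReal hp₁.ne' ht₁]
  calc (∫⁻ x, ‖f x‖ₑ ^ p.toReal ∂μ) ^ (1 / p.toReal)
      ≤ (∫⁻ x, (eLpNorm f₀ ⊤ μ) ^ ((1 - θ) * p.toReal) * f₁ x ^ p₁.toReal ∂μ)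
          ^ (1 / p.toReal) := by
        gcongr ?_ ^ _
        refine lintegral_mono_ae ?_
        filter_upwards [h0, hle] with x hx hx'
        calc ‖f x‖ₑ ^ p.toReal ≤ ((eLpNorm f₀ ⊤ μ) ^ (1 - θ) * f₁ x ^ θ) ^ p.toReal := by
              refine ENNReal.rpow_le_rpow (hx'.trans ?_) hP.le
              gcongr
          _ = _ := by
              rw [ENNReal.mul_rpow_of_nonneg _ _ hP.le, ← ENNReal.rpow_mul, ← ENNReal.rpow_mul,
                hθp]
    _ = _ := by
        rw [lintegral_const_mul'' _ (hf₁.pow_const _),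
          ENNReal.mul_rpow_of_nonneg _ _ (by positivity), ← ENNReal.rpow_mul, ← ENNReal.rpow_mul]
        congr 2
        · field_simp
        · rw [h]; ring

/-- **Hölder's inequality** in interpolated form, for exponents in `(0, ∞]`. -/
theorem eLpNorm_le_of_recip_eq (hf₀ : AEMeasurable f₀ μ) (hf₁ : AEMeasurable f₁ μ)
    {p p₀ p₁ : ℝ≥0∞} (hp : 0 < p) (hp₀ : 0 < p₀) (hp₁ : 0 < p₁) {θ : ℝ} (hθ₀ : 0 ≤ θ)
    (hθ₁ : θ ≤ 1) (h : recip p = (1 - θ) * recip p₀ + θ * recip p₁)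
    (hle : ∀ᵐ x ∂μ, f x ≤ f₀ x ^ (1 - θ) * f₁ x ^ θ) :
    eLpNorm f p μ ≤ eLpNorm f₀ p₀ μ ^ (1 - θ) * eLpNorm f₁ p₁ μ ^ θ := by
  by_cases ht₀ : p₀ = ⊤
  · subst ht₀
    exact eLpNorm_le_of_recip_eq_of_top hf₁ hp hp₁ hθ₀ hθ₁ (by simpa using h) hle
  by_cases ht₁ : p₁ = ⊤
  · subst ht₁
    rw [mul_comm]
    have := eLpNorm_le_of_recip_eq_of_top (f := f) (f₀ := f₁) hf₀ hp hp₀ (θ := 1 - θ)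
      (by linarith) (by linarith) (by simpa using h)
      (by simpa [mul_comm] using hle)
    simpa using this
  have hr₀ := recip_pos hp₀ ht₀
  have hr₁ := recip_pos hp₁ ht₁
  have hr : 0 < recip p := by
    rw [h]
    rcases hθ₀.eq_or_lt with rfl | hθ
    · simpa using hr₀
    · have := mul_pos hθ hr₁
      have := mul_nonneg (sub_nonneg.2 hθ₁) hr₀.le
      linarith
  have ht : p ≠ ⊤ := by rintro rfl; simp at hr
  have hP := ENNReal.toReal_pos hp.ne' ht
  have hP₀ := ENNReal.toReal_pos hp₀.ne' ht₀
  have hP₁ := ENNReal.toReal_pos hp₁.ne' ht₁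
  rw [recip_eq, recip_eq, recip_eq] at h
  rw [eLpNorm_eq_lintegral_rpow_enorm_toReal hp.ne' ht,
    eLpNorm_eq_lintegral_rpow_enorm_toReal hp₁.ne' ht₁,
    eLpNorm_eq_lintegral_rpow_enorm_toReal hp₀.ne' ht₀]
  set P := p.toReal
  set P₀ := p₀.toReal
  set P₁ := p₁.toReal
  -- These are the reciprocals of the Hölder conjugate exponents for `f₀ ^ P₀` and `f₁ ^ P₁`; they
  -- sum to `1` by the relation between the exponents.
  have ha : 0 ≤ (1 - θ) * P / P₀ := by have := sub_nonneg.2 hθ₁; positivity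
  have hb : 0 ≤ θ * P / P₁ := by positivity
  have hab : (1 - θ) * P / P₀ + θ * P / P₁ = 1 := by
    have : (1 - θ) * P / P₀ + θ * P / P₁ = P * (1 / P) := by rw [h]; ring
    rw [this]; field_simp
  calc (∫⁻ x, ‖f x‖ₑ ^ P ∂μ) ^ (1 / P)
      ≤ (∫⁻ x, (f₀ x ^ P₀) ^ ((1 - θ) * P / P₀) * (f₁ x ^ P₁) ^ (θ * P / P₁) ∂μ) ^ (1 / P) := by
        gcongr ?_ ^ _
        refine lintegral_mono_ae ?_
        filter_upwards [hle] with x hx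
        calc ‖f x‖ₑ ^ P ≤ (f₀ x ^ (1 - θ) * f₁ x ^ θ) ^ P := ENNReal.rpow_le_rpow hx hP.le
          _ = _ := by
              rw [ENNReal.mul_rpow_of_nonneg _ _ hP.le, ← ENNReal.rpow_mul, ← ENNReal.rpow_mul,
                ← ENNReal.rpow_mul, ← ENNReal.rpow_mul]
              congr 2 <;> field_simp
    _ ≤ ((∫⁻ x, f₀ x ^ P₀ ∂μ) ^ ((1 - θ) * P / P₀) * (∫⁻ x, f₁ x ^ P₁ ∂μ) ^ (θ * P / P₁))
          ^ (1 / P) := by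
        gcongr ?_ ^ _
        exact ENNReal.lintegral_mul_norm_pow_le (hf₀.pow_const _) (hf₁.pow_const _) ha hb hab
    _ = _ := by
        rw [ENNReal.mul_rpow_of_nonneg _ _ (by positivity), ← ENNReal.rpow_mul,
          ← ENNReal.rpow_mul, ← ENNReal.rpow_mul, ← ENNReal.rpow_mul]
        simp only [enorm_eq_self]
        congr 2 <;> field_simp

end Interpolation

/-! ### Quasi-norms of two-sided sequences. -/

section Sequences

lemma seqNorm_eq_eLpNorm {q : ℝ≥0∞} (hq : 0 < q) (a : ℤ → ℝ≥0∞) :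
    seqNorm q a = eLpNorm a q Measure.count := by
  unfold seqNorm
  split_ifs with h
  · subst h
    simp [eLpNorm_exponent_top, eLpNormEssSup]
  · rw [eLpNorm_eq_lintegral_rpow_enorm_toReal hq.ne' h, lintegral_count]
    simp

lemma le_seqNorm {q : ℝ≥0∞} (hq : 0 < q) (a : ℤ → ℝ≥0∞) (k : ℤ) : a k ≤ seqNorm q a := by
  unfold seqNorm
  split_ifs with h
  · exact le_iSup a k
  · have hQ := ENNReal.toReal_pos hq.ne' h
    calc a k = (a k ^ q.toReal) ^ (1 / q.toReal) := by
          rw [← ENNReal.rpow_mul, mul_one_div_cancel hQ.ne', ENNReal.rpow_one]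
      _ ≤ _ := by gcongr; exact ENNReal.le_tsum k

lemma seqNorm_mono {q : ℝ≥0∞} {a b : ℤ → ℝ≥0∞} (h : ∀ k, a k ≤ b k) :
    seqNorm q a ≤ seqNorm q b := by
  unfold seqNorm
  split_ifs
  · exact iSup_mono h
  · gcongr with k; exact h k

lemma seqNorm_const_mul {q : ℝ≥0∞} (hq : 0 < q) (c : ℝ≥0∞) (a : ℤ → ℝ≥0∞) :
    seqNorm q (fun k => c * a k) = c * seqNorm q a := by
  unfold seqNorm
  split_ifs with h
  · rw [ENNReal.mul_iSup]
  · have hQ := ENNReal.toReal_pos hq.ne' h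
    simp_rw [ENNReal.mul_rpow_of_nonneg _ _ hQ.le]
    rw [ENNReal.tsum_mul_left, ENNReal.mul_rpow_of_nonneg _ _ (by positivity),
      ← ENNReal.rpow_mul, mul_one_div_cancel hQ.ne', ENNReal.rpow_one]

lemma seqNorm_comp_add (q : ℝ≥0∞) (a : ℤ → ℝ≥0∞) (m : ℤ) :
    seqNorm q (fun k => a (k + m)) = seqNorm q a := by
  unfold seqNorm
  split_ifs
  · exact (Equiv.addRight m).iSup_congr fun _ => rfl
  · congr 1
    exact (Equiv.addRight m).tsum_eq (fun k => a k ^ q.toReal)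

/-- Every term is at most `A`, the `ℓ^r` norm, so `a k ^ q ≤ A ^ (q - r) * a k ^ r`; summing gives
`A ^ q`. -/
lemma seqNorm_le_seqNorm {q r : ℝ≥0∞} (hq : 0 < q) (hr : 0 < r) (h : recip q ≤ recip r)
    (a : ℤ → ℝ≥0∞) : seqNorm q a ≤ seqNorm r a := by
  by_cases hqt : q = ⊤
  · subst hqt
    simp only [seqNorm, if_true]
    exact iSup_le (le_seqNorm hr a)
  have hrt : r ≠ ⊤ := by
    rintro rfl
    have := recip_pos hq hqt
    simp at h; linarith
  have hQ := ENNReal.toReal_pos hq.ne' hqt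
  have hR := ENNReal.toReal_pos hr.ne' hrt
  have hle : r.toReal ≤ q.toReal := by
    rw [recip_eq, recip_eq] at h
    exact (one_div_le_one_div hQ hR).1 h
  set A := seqNorm r a with hA
  have hAr : ∑' k, a k ^ r.toReal = A ^ r.toReal := by
    rw [hA, seqNorm, if_neg hrt, ← ENNReal.rpow_mul, one_div_mul_cancel hR.ne', ENNReal.rpow_one]
  rw [seqNorm, if_neg hqt]
  calc (∑' k, a k ^ q.toReal) ^ (1 / q.toReal)
      ≤ (∑' k, A ^ (q.toReal - r.toReal) * a k ^ r.toReal) ^ (1 / q.toReal) := by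
        gcongr with k
        calc a k ^ q.toReal = a k ^ (q.toReal - r.toReal) * a k ^ r.toReal := by
              rw [← ENNReal.rpow_add_of_nonneg _ _ (by linarith) hR.le]; simp
          _ ≤ _ := by
              exact mul_le_mul_left (ENNReal.rpow_le_rpow (le_seqNorm hr a k) (by linarith)) _
    _ = A := by
        rw [ENNReal.tsum_mul_left, hAr, ← ENNReal.rpow_add_of_nonneg _ _ (by linarith) hR.le]
        rw [sub_add_cancel, ← ENNReal.rpow_mul, mul_one_div_cancel hQ.ne', ENNReal.rpow_one]

/-- Hölder's inequality for sequences, combined with the embedding `ℓ^r ⊆ ℓ^q`, `r ≤ q`. -/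
lemma seqNorm_rpow_mul_rpow_le {q q₀ q₁ : ℝ≥0∞} (hq : 0 < q) (hq₀ : 0 < q₀) (hq₁ : 0 < q₁)
    {θ : ℝ} (hθ₀ : 0 ≤ θ) (hθ₁ : θ ≤ 1) (h : recip q ≤ (1 - θ) * recip q₀ + θ * recip q₁)
    (a b : ℤ → ℝ≥0∞) :
    seqNorm q (fun k => a k ^ (1 - θ) * b k ^ θ) ≤
      seqNorm q₀ a ^ (1 - θ) * seqNorm q₁ b ^ θ := by
  obtain ⟨r, hr, hr'⟩ := exists_recip_eq ((recip_nonneg q).trans h)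
  refine (seqNorm_le_seqNorm hq hr (by rw [hr']; exact h) _).trans ?_
  rw [seqNorm_eq_eLpNorm hr, seqNorm_eq_eLpNorm hq₀, seqNorm_eq_eLpNorm hq₁]
  exact eLpNorm_le_of_recip_eq (measurable_of_countable a).aemeasurable
    (measurable_of_countable b).aemeasurable hr hq₀ hq₁ hθ₀ hθ₁ hr' (by simp)

lemma two_rpow_ne_zero (x : ℝ) : (2 : ℝ≥0∞) ^ x ≠ 0 := by simp [ENNReal.rpow_eq_zero_iff]

lemma two_rpow_ne_top (x : ℝ) : (2 : ℝ≥0∞) ^ x ≠ ⊤ := by simp [ENNReal.rpow_eq_top_iff]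

lemma two_rpow_add (x y : ℝ) : (2 : ℝ≥0∞) ^ (x + y) = 2 ^ x * 2 ^ y :=
  ENNReal.rpow_add _ _ (by simp) (by simp)

lemma two_rpow_le {x y : ℝ} (h : x ≤ y) : (2 : ℝ≥0∞) ^ x ≤ 2 ^ y :=
  ENNReal.rpow_le_rpow_of_exponent_le (by norm_num) h

lemma seqNorm_geometric_lt_top {q : ℝ≥0∞} (hq : 0 < q) {d : ℝ} (hd : 0 < d) :
    seqNorm q (fun k : ℤ => (2 : ℝ≥0∞) ^ (-(|(k : ℝ)| * d))) < ⊤ := by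
  unfold seqNorm
  split_ifs with h
  · refine lt_of_le_of_lt (iSup_le fun k => ?_) (ENNReal.one_lt_top)
    rw [← ENNReal.rpow_zero (x := 2)]
    exact two_rpow_le (by have := abs_nonneg (k : ℝ); nlinarith)
  · have hQ := ENNReal.toReal_pos hq.ne' h
    refine ENNReal.rpow_lt_top_of_nonneg (by positivity) ?_
    have hterm : ∀ k : ℤ, ((2 : ℝ≥0∞) ^ (-(|(k : ℝ)| * d))) ^ q.toReal
        = (2 : ℝ≥0∞) ^ (-(|(k : ℝ)| * (d * q.toReal))) := fun k => by
      rw [← ENNReal.rpow_mul]; congr 1; ring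
    simp_rw [hterm]
    have hnat : ∀ m : ℕ, (2 : ℝ≥0∞) ^ (-((m : ℝ) * (d * q.toReal)))
        = ((2 : ℝ≥0∞) ^ (-(d * q.toReal))) ^ m := fun m => by
      rw [← ENNReal.rpow_natCast, ← ENNReal.rpow_mul]; congr 1; ring
    have hlt : (2 : ℝ≥0∞) ^ (-(d * q.toReal)) < 1 := by
      refine ENNReal.rpow_lt_one_of_one_lt_of_neg (by norm_num) ?_
      have := mul_pos hd hQ; linarith
    have hfin : ∑' m : ℕ, ((2 : ℝ≥0∞) ^ (-(d * q.toReal))) ^ m ≠ ⊤ := by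
      rw [ENNReal.tsum_geometric]
      rw [Ne, ENNReal.inv_eq_top, tsub_eq_zero_iff_le]
      exact not_le.2 hlt
    rw [tsum_of_nat_of_neg_add_one ENNReal.summable ENNReal.summable]
    refine ENNReal.add_ne_top.2 ⟨?_, ?_⟩
    · simpa [hnat] using hfin
    · refine ne_top_of_le_ne_top hfin (ENNReal.tsum_le_tsum fun m => ?_)
      rw [← hnat]
      refine two_rpow_le ?_
      have hm : |((-((m : ℤ) + 1) : ℤ) : ℝ)| = (m : ℝ) + 1 := by
        push_cast; rw [abs_neg, abs_of_nonneg (by positivity)]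
      rw [hm]
      have := mul_pos hd hQ; nlinarith

/-- A sequence dominated by two opposite geometric sequences is summable, with a bound
independent of the point at which they cross. -/
lemma exists_seqNorm_le_of_two_sided {q : ℝ≥0∞} (hq : 0 < q) {d : ℝ} (hd : d ≠ 0) :
    ∃ C : ℝ≥0, ∀ (a : ℤ → ℝ≥0∞) (Q : ℝ≥0∞) (y : ℝ),
      (∀ k : ℤ, a k ≤ Q * 2 ^ (k * d + y)) → (∀ k : ℤ, a k ≤ Q * 2 ^ (-(k * d + y))) →
        seqNorm q a ≤ C * Q := by
  have hd' : 0 < |d| := abs_pos.2 hd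
  set G := seqNorm q (fun k : ℤ => (2 : ℝ≥0∞) ^ (-(|(k : ℝ)| * |d|))) with hG
  have hGt : G < ⊤ := seqNorm_geometric_lt_top hq hd'
  refine ⟨((2 : ℝ≥0∞) ^ |d| * G).toNNReal, fun a Q y h1 h2 => ?_⟩
  rw [ENNReal.coe_toNNReal (ENNReal.mul_ne_top (two_rpow_ne_top _) hGt.ne)]
  set m : ℤ := ⌊y / d⌋
  have key : ∀ k : ℤ, a k ≤ (Q * 2 ^ |d|) * 2 ^ (-(|((k + m : ℤ) : ℝ)| * |d|)) := fun k => by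
    have hmin : a k ≤ Q * 2 ^ (-|(k : ℝ) * d + y|) := by
      rcases abs_cases ((k : ℝ) * d + y) with h | h
      · rw [h.1]; exact h2 k
      · rw [h.1, neg_neg]; exact h1 k
    refine hmin.trans ?_
    rw [mul_assoc, ← two_rpow_add]
    refine mul_le_mul_right (two_rpow_le ?_) _
    have e : (k : ℝ) * d + y = (k + y / d) * d := by field_simp
    rw [e, abs_mul]
    have hm1 : (m : ℝ) ≤ y / d := Int.floor_le _
    have hm2 : y / d < m + 1 := Int.lt_floor_add_one _
    have : |((k + m : ℤ) : ℝ)| ≤ |(k : ℝ) + y / d| + 1 := by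
      push_cast
      have : (k : ℝ) + m = (k + y / d) + (m - y / d) := by ring
      rw [this]
      refine (abs_add_le _ _).trans ?_
      gcongr
      rw [abs_le]; constructor <;> linarith
    nlinarith
  refine (seqNorm_mono key).trans ?_
  rw [seqNorm_const_mul hq,
    seqNorm_comp_add q (fun k : ℤ => (2 : ℝ≥0∞) ^ (-(|(k : ℝ)| * |d|))) m, ← hG]
  rw [mul_comm Q, mul_assoc, mul_assoc, mul_comm Q]

/-- Upper bound for a finitely supported sequence. -/
lemma seqNorm_le_of_support {q : ℝ≥0∞} (hq : 0 < q) {a : ℤ → ℝ≥0∞} (S : Finset ℤ) {A : ℝ≥0∞}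
    (h : ∀ k ∈ S, a k ≤ A) (h0 : ∀ k ∉ S, a k = 0) :
    seqNorm q a ≤ A * (S.card : ℝ≥0∞) ^ recip q := by
  unfold seqNorm
  split_ifs with ht
  · subst ht
    simp only [recip_top, ENNReal.rpow_zero, mul_one]
    refine iSup_le fun k => ?_
    by_cases hk : k ∈ S
    · exact h k hk
    · simp [h0 k hk]
  · have hQ := ENNReal.toReal_pos hq.ne' ht
    rw [tsum_eq_sum (s := S) (fun k hk => by simp [h0 k hk, hQ])]
    calc (∑ k ∈ S, a k ^ q.toReal) ^ (1 / q.toReal)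
        ≤ (∑ k ∈ S, A ^ q.toReal) ^ (1 / q.toReal) := by
          gcongr with k hk; exact h k hk
      _ = _ := by
          rw [Finset.sum_const, nsmul_eq_mul, ENNReal.mul_rpow_of_nonneg _ _ (by positivity),
            ← ENNReal.rpow_mul, mul_one_div_cancel hQ.ne', ENNReal.rpow_one, recip_eq, mul_comm]

lemma le_seqNorm_of_le {q : ℝ≥0∞} (hq : 0 < q) {a : ℤ → ℝ≥0∞} (S : Finset ℤ) (hS : S.Nonempty)
    {B : ℝ≥0∞} (h : ∀ k ∈ S, B ≤ a k) :
    B * (S.card : ℝ≥0∞) ^ recip q ≤ seqNorm q a := by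
  by_cases ht : q = ⊤
  · subst ht
    obtain ⟨k, hk⟩ := hS
    simpa using (h k hk).trans (le_seqNorm hq a k)
  · have hQ := ENNReal.toReal_pos hq.ne' ht
    rw [seqNorm, if_neg ht]
    calc B * (S.card : ℝ≥0∞) ^ recip q = (∑ k ∈ S, B ^ q.toReal) ^ (1 / q.toReal) := by
          rw [Finset.sum_const, nsmul_eq_mul, ENNReal.mul_rpow_of_nonneg _ _ (by positivity),
            ← ENNReal.rpow_mul, mul_one_div_cancel hQ.ne', ENNReal.rpow_one, recip_eq, mul_comm]
      _ ≤ (∑ k ∈ S, a k ^ q.toReal) ^ (1 / q.toReal) := by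
          gcongr with k hk; exact h k hk
      _ ≤ _ := by gcongr; exact ENNReal.sum_le_tsum S

end Sequences

/-! ### Schwartz functions: products, dilations, cut-offs, convolutions. -/

section Fourier

open FourierTransform SchwartzMap

variable {E : Type*} [NormedAddCommGroup E] [InnerProductSpace ℝ E]

/-- The product of two Schwartz functions. -/
noncomputable def schwartzMul (f g : 𝓢(E, ℂ)) : 𝓢(E, ℂ) :=
  pairing (ContinuousLinearMap.mul ℂ ℂ) f g

@[simp] lemma schwartzMul_apply (f g : 𝓢(E, ℂ)) (x : E) : schwartzMul f g x = f x * g x := rfl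

/-- The dilation `x ↦ f (c x)` of a Schwartz function. -/
noncomputable def dilate (c : ℝˣ) (f : 𝓢(E, ℂ)) : 𝓢(E, ℂ) :=
  compCLMOfContinuousLinearEquiv ℂ (ContinuousLinearEquiv.smulLeft (R₁ := ℝ) (M₁ := E) c) f

@[simp] lemma dilate_apply (c : ℝˣ) (f : 𝓢(E, ℂ)) (x : E) : dilate c f x = f ((c : ℝ) • x) := rfl

variable [FiniteDimensional ℝ E]

/-- A smooth non-negative cut-off, equal to `1` on the ball of radius `r` and vanishing off the ball of
radius `2 r`. -/
lemma exists_schwartz_cutoff (r : ℝ) (hr : 0 < r) :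
    ∃ χ : 𝓢(E, ℂ), (∀ x, ‖x‖ ≤ r → χ x = 1) ∧ (∀ x, 2 * r ≤ ‖x‖ → χ x = 0) ∧
      ∀ x, ∃ t : ℝ, 0 ≤ t ∧ χ x = t := by
  let b : ContDiffBump (0 : E) := ⟨r, 2 * r, hr, by linarith⟩
  have hs : HasCompactSupport (fun x => (b x : ℂ)) :=
    b.hasCompactSupport.comp_left (g := fun t : ℝ => (t : ℂ)) (by simp)
  have hc : ContDiff ℝ ∞ (fun x => (b x : ℂ)) := Complex.ofRealCLM.contDiff.comp b.contDiff
  refine ⟨hs.toSchwartzMap hc, fun x hx => ?_, fun x hx => ?_, fun x => ⟨b x, b.nonneg, rfl⟩⟩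
  · have : b x = 1 := b.one_of_mem_closedBall (by simpa using hx)
    simp [this]
  · have : b x = 0 := b.zero_of_le_dist (by simpa using hx)
    simp [this]

variable [MeasurableSpace E] [BorelSpace E]

lemma fourier_dilate_apply (c : ℝˣ) (f : 𝓢(E, ℂ)) (x : E) :
    𝓕 (dilate c f) x = ((|(c : ℝ)| ^ Module.finrank ℝ E)⁻¹ : ℝ) • 𝓕 f ((c : ℝ)⁻¹ • x) := by
  rw [fourier_coe, fourier_coe, Real.fourier_eq, Real.fourier_eq]
  have := Measure.integral_comp_smul (volume : Measure E)
    (fun v => Real.fourierChar (-inner ℝ v ((c : ℝ)⁻¹ • x)) • f v) (c : ℝ)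
  rw [abs_inv, abs_pow] at this
  rw [← this]
  congr 1
  ext v
  rw [dilate_apply, real_inner_smul_left, real_inner_smul_right]
  congr 3
  have := c.ne_zero
  field_simp

lemma fourierInv_apply_eq_fourier_neg (f : 𝓢(E, ℂ)) (x : E) : 𝓕⁻ f x = 𝓕 f (-x) := by
  rw [fourierInv_coe, fourier_coe, Real.fourierInv_eq_fourier_neg]

lemma fourierInv_dilate_apply (c : ℝˣ) (f : 𝓢(E, ℂ)) (x : E) :
    𝓕⁻ (dilate c f) x = ((|(c : ℝ)| ^ Module.finrank ℝ E)⁻¹ : ℝ) • 𝓕⁻ f ((c : ℝ)⁻¹ • x) := by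
  rw [fourierInv_apply_eq_fourier_neg, fourier_dilate_apply, fourierInv_apply_eq_fourier_neg,
    smul_neg]

lemma fourierInv_schwartzMul_apply (a b : 𝓢(E, ℂ)) (x : E) :
    𝓕⁻ (schwartzMul a b) x = ∫ y, 𝓕⁻ a y * 𝓕⁻ b (x - y) := by
  have h := fourier_convolution (ContinuousLinearMap.mul ℂ ℂ) (𝓕⁻ a) (𝓕⁻ b)
  rw [fourier_fourierInv_eq, fourier_fourierInv_eq] at h
  have h2 : 𝓕⁻ (schwartzMul a b) = SchwartzMap.convolution (ContinuousLinearMap.mul ℂ ℂ) (𝓕⁻ a) (𝓕⁻ b) := by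
    rw [schwartzMul, ← h, fourierInv_fourier_eq]
  rw [h2, convolution_apply]
  rfl

lemma fourier_schwartzMul_apply (a b : 𝓢(E, ℂ)) (x : E) :
    𝓕 (schwartzMul a b) x = ∫ y, 𝓕 a y * 𝓕 b (x - y) := by
  have := fourierInv_schwartzMul_apply a b (-x)
  rw [fourierInv_apply_eq_fourier_neg, neg_neg] at this
  rw [this, ← integral_neg_eq_self]
  congr 1
  ext y
  rw [fourierInv_apply_eq_fourier_neg, fourierInv_apply_eq_fourier_neg]
  congr 2 <;> abel_nf

/-- The product of two Fourier transforms is the Fourier transform of the convolution. -/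
lemma fourierInv_schwartzMul_fourier_apply (a b : 𝓢(E, ℂ)) (x : E) :
    𝓕⁻ (schwartzMul (𝓕 a) (𝓕 b)) x = ∫ y, a y * b (x - y) := by
  simp [fourierInv_schwartzMul_apply]

end Fourier

/-! ### The dyadic partition functions. -/

section Dyadic

variable {n : ℕ} {ψ : EuclideanSpace ℝ (Fin n) → ℝ}

lemma dyadic_eq_dyadic_zero (k : ℤ) (ψ : EuclideanSpace ℝ (Fin n) → ℝ) (ξ : EuclideanSpace ℝ (Fin n)) :
    dyadic ψ k ξ = dyadic ψ 0 (((2 : ℝ) ^ (-k)) • ξ) := by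
  simp [dyadic]

lemma IsCutoff.apply_eq_zero (hψ : IsCutoff ψ) {ξ : EuclideanSpace ℝ (Fin n)} (h : 2 < ‖ξ‖) :
    ψ ξ = 0 := by
  by_contra h0
  have := hψ.support (subset_tsupport ψ (Function.mem_support.2 h0))
  simp at this; linarith

lemma IsCutoff.dyadic_zero_eq_zero (hψ : IsCutoff ψ) {ξ : EuclideanSpace ℝ (Fin n)}
    (h : 2 < ‖ξ‖) : dyadic ψ 0 ξ = 0 := by
  simp only [dyadic, neg_zero, zpow_zero, one_smul]
  rw [hψ.apply_eq_zero h, hψ.apply_eq_zero, sub_zero]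
  rw [norm_smul]; norm_num; linarith

lemma IsCutoff.exists_dyadic_zero_eq_zero (hψ : IsCutoff ψ) :
    ∃ c : ℝ, 0 < c ∧ ∀ ξ : EuclideanSpace ℝ (Fin n), ‖ξ‖ < c → dyadic ψ 0 ξ = 0 := by
  obtain ⟨c, hc, h⟩ := Metric.eventually_nhds_iff.1 hψ.eq_one
  refine ⟨c / 2, by linarith, fun ξ hξ => ?_⟩
  simp only [dyadic, neg_zero, zpow_zero, one_smul]
  rw [h (by simp; linarith), h (by simp [norm_smul]; linarith), sub_self]

lemma IsCutoff.contDiff_dyadic (hψ : IsCutoff ψ) (k : ℤ) : ContDiff ℝ ∞ (dyadic ψ k) := by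
  have := hψ.smooth
  unfold dyadic
  fun_prop

lemma IsCutoff.hasCompactSupport_dyadic (hψ : IsCutoff ψ) (k : ℤ) :
    HasCompactSupport (dyadic ψ k) := by
  refine HasCompactSupport.of_support_subset_isCompact
    (isCompact_closedBall (0 : EuclideanSpace ℝ (Fin n)) (2 * 2 ^ k)) fun ξ hξ => ?_
  by_contra h
  rw [mem_closedBall_zero_iff, not_le] at h
  refine hξ ?_
  rw [dyadic_eq_dyadic_zero]
  apply hψ.dyadic_zero_eq_zero
  rw [norm_smul, norm_zpow, zpow_neg, Real.norm_ofNat]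
  have : (0:ℝ) < 2 ^ k := by positivity
  rw [inv_mul_eq_div, lt_div_iff₀ this]; exact h

/-- The dyadic function as a Schwartz function. -/
noncomputable def IsCutoff.dyadicSchwartz (hψ : IsCutoff ψ) (k : ℤ) :
    𝓢(EuclideanSpace ℝ (Fin n), ℂ) :=
  HasCompactSupport.toSchwartzMap (f := fun ξ => (dyadic ψ k ξ : ℂ))
    ((hψ.hasCompactSupport_dyadic k).comp_left (g := fun t : ℝ => (t : ℂ)) (by simp))
    (Complex.ofRealCLM.contDiff.comp (hψ.contDiff_dyadic k))

@[simp] lemma IsCutoff.dyadicSchwartz_apply (hψ : IsCutoff ψ) (k : ℤ)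
    (ξ : EuclideanSpace ℝ (Fin n)) : hψ.dyadicSchwartz k ξ = dyadic ψ k ξ := rfl

lemma IsCutoff.hasTemperateGrowth_dyadic (hψ : IsCutoff ψ) (k : ℤ) :
    (fun ξ => (dyadic ψ k ξ : ℂ)).HasTemperateGrowth :=
  (hψ.dyadicSchwartz k).hasTemperateGrowth

/-- If `φ ≤ 0` everywhere, then `ψ ξ ≤ ψ (2 ξ)`, so the value `1` near the origin would propagate
along `2 ^ m • x` and contradict the bounded support. A nonzero `x` exists because `n ≥ 1`. The wave
packets are centred at multiples of the point found here. -/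
lemma IsCutoff.exists_dyadic_zero_pos (hn : 1 ≤ n) (hψ : IsCutoff ψ) : ∃ ξ, 0 < dyadic ψ 0 ξ := by
  by_contra! h
  obtain ⟨c, hc, h1⟩ := Metric.eventually_nhds_iff.1 hψ.eq_one
  have : Nonempty (Fin n) := ⟨⟨0, hn⟩⟩
  obtain ⟨x, hx⟩ := exists_norm_eq (EuclideanSpace ℝ (Fin n)) (c := c / 2) (by linarith)
  have hmono : ∀ m : ℕ, 1 ≤ ψ ((2 : ℝ) ^ m • x) := by
    intro m
    induction m with
    | zero => rw [h1 (by simp [hx]; linarith)]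
    | succ m ih =>
      have := h ((2 : ℝ) ^ m • x)
      simp only [dyadic, neg_zero, zpow_zero, one_smul] at this
      rw [pow_succ', ← smul_smul]; linarith
  obtain ⟨m, hm⟩ := pow_unbounded_of_one_lt (2 / (c / 2)) (one_lt_two (α := ℝ))
  have := hmono m
  rw [hψ.apply_eq_zero] at this
  · linarith
  · rw [norm_smul, hx, norm_pow, Real.norm_ofNat]
    rwa [div_lt_iff₀ (by linarith)] at hm

end Dyadic

/-! ### Tempered distributions given by functions. -/

section Representation

open FourierTransform

variable {n : ℕ} {T : 𝓢'(EuclideanSpace ℝ (Fin n), ℂ)} {g g' : EuclideanSpace ℝ (Fin n) → ℂ}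

lemma exists_schwartz_eq_one_on_closedBall (r : ℝ) :
    ∃ χ : 𝓢(EuclideanSpace ℝ (Fin n), ℂ), ∀ x, ‖x‖ ≤ r → χ x = 1 := by
  obtain ⟨χ, h, -⟩ := exists_schwartz_cutoff (E := EuclideanSpace ℝ (Fin n)) (max r 1) (by simp)
  exact ⟨χ, fun x hx => h x (hx.trans (le_max_left _ _))⟩

lemma IsRepresentedBy.locallyIntegrable (h : IsRepresentedBy T g) : LocallyIntegrable g := by
  rw [locallyIntegrable_iff]
  intro K hK
  obtain ⟨r, hr⟩ := hK.isBounded.subset_closedBall (0 : EuclideanSpace ℝ (Fin n))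
  obtain ⟨χ, hχ⟩ := exists_schwartz_eq_one_on_closedBall (n := n) r
  refine ((h χ).1.integrableOn (s := K)).congr_fun (fun x hx => ?_) hK.measurableSet
  simp [hχ x (by simpa using hr hx)]

lemma ae_eq_of_schwartz_integral_eq (hg : LocallyIntegrable g) (hg' : LocallyIntegrable g')
    (h : ∀ f : 𝓢(EuclideanSpace ℝ (Fin n), ℂ), ∫ x, f x * g x = ∫ x, f x * g' x) :
    g =ᵐ[volume] g' := by
  refine ae_eq_of_integral_contDiff_smul_eq hg hg' fun f hf hs => ?_
  have := h (HasCompactSupport.toSchwartzMap (f := fun ξ => (f ξ : ℂ))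
    (hs.comp_left (g := fun t : ℝ => (t : ℂ)) (by simp)) (Complex.ofRealCLM.contDiff.comp hf))
  simp only [Complex.real_smul]
  exact this

lemma IsRepresentedBy.ae_eq (h : IsRepresentedBy T g) (h' : IsRepresentedBy T g') :
    g =ᵐ[volume] g' :=
  ae_eq_of_schwartz_integral_eq h.locallyIntegrable h'.locallyIntegrable
    fun f => by rw [← (h f).2, ← (h' f).2]

/-- Two representing functions agree almost everywhere, so the infimum runs over a single value. -/
lemma IsRepresentedBy.distLpNorm_eq (h : IsRepresentedBy T g) (p : ℝ≥0∞) :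
    distLpNorm p T = eLpNorm g p volume :=
  le_antisymm (iInf₂_le g h) (le_iInf₂ fun _ h' => (eLpNorm_congr_ae (h.ae_eq h')).le)

lemma exists_isRepresentedBy_of_distLpNorm_lt_top {p : ℝ≥0∞} (h : distLpNorm p T < ⊤) :
    ∃ g, IsRepresentedBy T g := by
  by_contra! h'
  simp [distLpNorm, h'] at h

lemma isRepresentedBy_coe (F : 𝓢(EuclideanSpace ℝ (Fin n), ℂ)) :
    IsRepresentedBy (F : 𝓢'(EuclideanSpace ℝ (Fin n), ℂ)) F := fun f =>
  ⟨(schwartzMul f F).integrable, by simp⟩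

lemma block_coe {ψ : EuclideanSpace ℝ (Fin n) → ℝ} (hψ : IsCutoff ψ) (k : ℤ)
    (F : 𝓢(EuclideanSpace ℝ (Fin n), ℂ)) :
    block ψ k (𝓕⁻ F : 𝓢(EuclideanSpace ℝ (Fin n), ℂ)) =
      (𝓕⁻ (schwartzMul (hψ.dyadicSchwartz k) F) : 𝓢(EuclideanSpace ℝ (Fin n), ℂ)) := by
  rw [block, TemperedDistribution.fourierMultiplierCLM_toTemperedDistributionCLM_eq
    (hψ.hasTemperateGrowth_dyadic k), SchwartzMap.fourierMultiplierCLM_apply,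
    FourierTransform.fourier_fourierInv_eq]
  congr 2
  ext x
  rw [SchwartzMap.smulLeftCLM_apply_apply (hψ.hasTemperateGrowth_dyadic k)]
  simp

end Representation

/-! ### Dilations and Lebesgue norms. -/

section Scaling

variable {E : Type*} [NormedAddCommGroup E] [InnerProductSpace ℝ E] [FiniteDimensional ℝ E]
  [MeasurableSpace E] [BorelSpace E] {F : Type*} [NormedAddCommGroup F]

lemma eLpNorm_comp_smul {f : E → F} (hf : StronglyMeasurable f) (p : ℝ≥0∞) {c : ℝ} (hc : 0 < c) :
    eLpNorm (fun x => f (c • x)) p volume =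
      ENNReal.ofReal c ^ (-((Module.finrank ℝ E : ℝ) * recip p)) * eLpNorm f p volume := by
  have hm := Measure.map_addHaar_smul (volume : Measure E) hc.ne'
  have h1 := eLpNorm_map_measure (p := p) (μ := (volume : Measure E)) (f := fun x => c • x) (g := f)
    hf.aestronglyMeasurable (measurable_const_smul c).aemeasurable
  have hpos : 0 < |(c ^ Module.finrank ℝ E)⁻¹| := by positivity
  rw [hm, eLpNorm_smul_measure_of_ne_zero (by simpa using hpos)] at h1
  change _ = eLpNorm (fun x => f (c • x)) p volume at h1
  rw [← h1, smul_eq_mul]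
  congr 1
  rw [abs_of_pos (by positivity), ENNReal.ofReal_inv_of_pos (by positivity),
    ENNReal.ofReal_pow hc.le, ← ENNReal.rpow_natCast, ← ENNReal.rpow_neg, ← ENNReal.rpow_mul,
    recip, one_div, neg_mul]

end Scaling

/-! ### Sup bounds from a reproducing kernel. -/

section SelfReproducing

variable {α : Type*} [MeasurableSpace α] {μ : Measure α}

/-- A function reproduced by a bounded kernel is bounded in terms of its `L^r` quasi-norm. -/
lemma eLpNormEssSup_le_of_reproducing {G : α → ℂ} {K : α → α → ℂ} {κ J r : ℝ≥0∞}
    (hG : Integrable G μ) (hκ0 : κ ≠ 0) (hκ : κ ≠ ⊤) (hK : ∀ x y, ‖K x y‖ₑ ≤ κ)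
    (hJ : ∀ x, ∫⁻ y, ‖K x y‖ₑ ∂μ ≤ J) (hrep : ∀ᵐ x ∂μ, G x = ∫ y, K x y * G y ∂μ)
    (hKm : ∀ x, AEStronglyMeasurable (K x) μ)
    (hr : 0 < r) (hrt : r ≠ ⊤) :
    eLpNormEssSup G μ ≤ (J + 1) * κ ^ recip r * eLpNorm G r μ := by
  have hP := ENNReal.toReal_pos hr.ne' hrt
  set P := r.toReal with hPdef
  set M := eLpNormEssSup G μ
  have hpt : ∀ᵐ x ∂μ, ‖G x‖ₑ ≤ ∫⁻ y, ‖K x y‖ₑ * ‖G y‖ₑ ∂μ := by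
    filter_upwards [hrep] with x hx
    rw [hx]
    refine (enorm_integral_le_lintegral_enorm _).trans_eq ?_
    simp_rw [enorm_mul]
  have hMle : ∀ᵐ x ∂μ, ‖G x‖ₑ ≤ M := ae_le_eLpNormEssSup
  have hNP : eLpNorm G r μ ^ P = ∫⁻ y, ‖G y‖ₑ ^ P ∂μ := by
    rw [eLpNorm_eq_lintegral_rpow_enorm_toReal hr.ne' hrt, ← ENNReal.rpow_mul,
      one_div_mul_cancel hP.ne', ENNReal.rpow_one]
  set N := eLpNorm G r μ
  -- Integrability of `G` and boundedness of the kernel make `M` finite; without this one could not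
  -- divide by `M ^ (1 - P)` below.
  have hM : M ≠ ⊤ := by
    refine ne_top_of_le_ne_top (ENNReal.mul_ne_top hκ hG.2.ne)
      (eLpNormEssSup_le_of_ae_enorm_bound (C := κ * ∫⁻ y, ‖G y‖ₑ ∂μ) ?_)
    filter_upwards [hpt] with x hx
    refine hx.trans ?_
    rw [← lintegral_const_mul'' _ hG.1.enorm]
    gcongr with y
    exact hK x y
  have hκP : (κ ^ recip r) ^ P = κ := by
    rw [← ENNReal.rpow_mul, recip_eq, ← hPdef, one_div_mul_cancel hP.ne', ENNReal.rpow_one]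
  have hκr0 : κ ^ recip r ≠ 0 := by simp [ENNReal.rpow_eq_zero_iff, hκ0, hκ]
  have hκrt : κ ^ recip r ≠ ⊤ := by simp [ENNReal.rpow_eq_top_iff, hκ0, hκ]
  by_cases hM0 : M = 0
  · simp [hM0]
  rcases le_or_gt P 1 with hP1 | hP1
  -- For `P ≤ 1`, part of `|G|` is replaced by its supremum: `|G| ≤ M ^ (1 - P) * |G| ^ P`.
  · have h1 : M ≤ κ * (M ^ (1 - P) * N ^ P) := by
      refine eLpNormEssSup_le_of_ae_enorm_bound ?_
      filter_upwards [hpt] with x hx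
      refine hx.trans ?_
      rw [hNP, ← lintegral_const_mul'' _ (hG.1.enorm.pow_const _),
        ← lintegral_const_mul'' _ ((hG.1.enorm.pow_const _).const_mul _)]
      refine lintegral_mono_ae ?_
      filter_upwards [hMle] with y hy
      refine mul_le_mul' (hK x y) ?_
      calc ‖G y‖ₑ = ‖G y‖ₑ ^ (1 - P) * ‖G y‖ₑ ^ P := by
            rw [← ENNReal.rpow_add_of_nonneg _ _ (by linarith) hP.le]; simp
        _ ≤ _ := by gcongr
    have h2 : M ^ P ≤ κ * N ^ P := by
      have hMP0 : M ^ (1 - P) ≠ 0 := by simp [ENNReal.rpow_eq_zero_iff, hM0, hM]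
      have hMPt : M ^ (1 - P) ≠ ⊤ := by simp [ENNReal.rpow_eq_top_iff, hM0, hM]
      rw [← ENNReal.mul_le_mul_iff_right hMP0 hMPt,
        ← ENNReal.rpow_add_of_nonneg _ _ (by linarith) hP.le]
      simp only [sub_add_cancel, ENNReal.rpow_one]
      exact h1.trans_eq (by ring)
    have h3 : M ^ P ≤ (κ ^ recip r * N) ^ P := by
      rw [ENNReal.mul_rpow_of_nonneg _ _ hP.le, hκP]; exact h2
    calc M ≤ 1 * (κ ^ recip r * N) := by
          rw [one_mul]; exact (ENNReal.rpow_le_rpow_iff hP).1 h3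
      _ ≤ _ := by rw [mul_assoc]; gcongr; simp
  · by_cases hN0 : N = 0
    · have := (eLpNorm_eq_zero_iff hG.1 hr.ne').1 hN0
      exact absurd (eLpNormEssSup_congr_ae this |>.trans (by simp)) hM0
    by_cases hNt : N = ⊤
    · rw [hNt, ENNReal.mul_top (by simp [hκr0])]; simp
    -- For `P > 1` the integral is split at height `t`. The low values contribute at most `t * J`;
    -- on the high ones `|G| ≤ t ^ (1 - P) * |G| ^ P`, which contributes at most `κ * t ^ (1 - P) *
    -- N ^ P`. The choice of `t` makes the latter equal to `t`.
    set t := κ ^ recip r * N with ht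
    have ht0 : t ≠ 0 := mul_ne_zero hκr0 hN0
    have htt : t ≠ ⊤ := ENNReal.mul_ne_top hκrt hNt
    have htP : κ * N ^ P = t ^ P := by rw [ht, ENNReal.mul_rpow_of_nonneg _ _ hP.le, hκP]
    refine eLpNormEssSup_le_of_ae_enorm_bound ?_
    filter_upwards [hpt] with x hx
    refine hx.trans ?_
    calc ∫⁻ y, ‖K x y‖ₑ * ‖G y‖ₑ ∂μ
        ≤ ∫⁻ y, (t * ‖K x y‖ₑ + (κ * t ^ (1 - P)) * ‖G y‖ₑ ^ P) ∂μ := by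
          refine lintegral_mono fun y => ?_
          rcases le_or_gt ‖G y‖ₑ t with h | h
          · calc ‖K x y‖ₑ * ‖G y‖ₑ ≤ t * ‖K x y‖ₑ := by rw [mul_comm]; gcongr
              _ ≤ _ := le_self_add
          · refine le_trans ?_ le_add_self
            rw [mul_assoc]
            refine mul_le_mul' (hK x y) ?_
            have h0 : ‖G y‖ₑ ≠ 0 := (pos_of_gt h).ne'
            calc ‖G y‖ₑ = ‖G y‖ₑ ^ (1 - P) * ‖G y‖ₑ ^ P := by
                  rw [← ENNReal.rpow_add _ _ h0 (by simp)]; simp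
              _ ≤ _ := by
                  refine mul_le_mul_left ?_ _
                  rw [← neg_sub P 1, ENNReal.rpow_neg, ENNReal.rpow_neg]
                  exact ENNReal.inv_le_inv.2 (ENNReal.rpow_le_rpow h.le (by linarith))
      _ = t * ∫⁻ y, ‖K x y‖ₑ ∂μ + (κ * t ^ (1 - P)) * N ^ P := by
          rw [lintegral_add_left' ((hKm x).enorm.const_mul _), lintegral_const_mul'' _ (hKm x).enorm,
            lintegral_const_mul'' _ (hG.1.enorm.pow_const _), hNP]
      _ ≤ t * J + t := by
          gcongr
          · exact hJ x
          · rw [mul_right_comm, htP, ← ENNReal.rpow_add _ _ ht0 htt]; simp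
      _ = _ := by rw [ht]; ring

end SelfReproducing

/-! ### Nikolskii's inequality for spectra in a ball. -/

section Nikolskii

open FourierTransform SchwartzMap

variable {n : ℕ} {T : 𝓢'(EuclideanSpace ℝ (Fin n), ℂ)} {g : EuclideanSpace ℝ (Fin n) → ℂ}

/-- The Fourier transform of the tempered distribution `T` is supported in the closed ball of
radius `r`, in the sense that `T` kills the functions with spectrum off this ball. -/
def HasSpectrumInBall (T : 𝓢'(EuclideanSpace ℝ (Fin n), ℂ)) (r : ℝ) : Prop :=
  ∀ f : 𝓢(EuclideanSpace ℝ (Fin n), ℂ), (∀ ξ, ‖ξ‖ ≤ r → 𝓕⁻ f ξ = 0) → T f = 0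

lemma IsCutoff.hasSpectrumInBall_block {ψ : EuclideanSpace ℝ (Fin n) → ℝ} (hψ : IsCutoff ψ)
    (k : ℤ) (u : 𝓢'(EuclideanSpace ℝ (Fin n), ℂ)) :
    HasSpectrumInBall (block ψ k u) (2 * 2 ^ k) := by
  intro f hf
  rw [block, TemperedDistribution.fourierMultiplierCLM_apply_apply]
  have : smulLeftCLM ℂ (fun ξ => (dyadic ψ k ξ : ℂ)) (𝓕⁻ f) = 0 := by
    ext ξ
    rw [smulLeftCLM_apply_apply (hψ.hasTemperateGrowth_dyadic k)]
    by_cases h : ‖ξ‖ ≤ 2 * 2 ^ k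
    · simp [hf ξ h]
    · rw [not_le] at h
      rw [dyadic_eq_dyadic_zero, hψ.dyadic_zero_eq_zero]
      · simp
      · rw [norm_smul, norm_zpow, zpow_neg, Real.norm_ofNat]
        have : (0:ℝ) < 2 ^ k := by positivity
        rw [inv_mul_eq_div, lt_div_iff₀ this]; exact h
  rw [this]
  have h0 : 𝓕 (0 : 𝓢(EuclideanSpace ℝ (Fin n), ℂ)) = 0 :=
    map_zero (fourierCLM ℂ 𝓢(EuclideanSpace ℝ (Fin n), ℂ))
  rw [h0, map_zero]

/-- Multiplication by `𝓕 a` enlarges the spectrum by at most `R`, so the product has spectrum in the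
ball of radius `3 R`, where `χ = 1`; convolving with the kernel of `χ` changes nothing. The factor
`𝓕 a` is there to make the product integrable. -/
lemma HasSpectrumInBall.ae_reproducing {R : ℝ} (hT : HasSpectrumInBall T (2 * R))
    (hg : IsRepresentedBy T g) {a χ : 𝓢(EuclideanSpace ℝ (Fin n), ℂ)}
    (ha : ∀ ξ, R ≤ ‖ξ‖ → a ξ = 0) (hχ : ∀ ξ, ‖ξ‖ ≤ 3 * R → χ ξ = 1) :
    ∀ᵐ x, 𝓕 a x * g x = ∫ y, 𝓕 χ (y - x) * (𝓕 a y * g y) := by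
  have hG : Integrable (fun x => 𝓕 a x * g x) := (hg (𝓕 a)).1
  have hconv := hG.convolution_integrand (ContinuousLinearMap.mul ℂ ℂ)
    (g := fun x => 𝓕 χ (-x)) (μ := volume) ((𝓕 χ).integrable.comp_neg)
  simp only [ContinuousLinearMap.mul_apply', neg_sub] at hconv
  have hint : Integrable (fun x => ∫ y, 𝓕 χ (y - x) * (𝓕 a y * g y)) := by
    simpa [mul_comm] using hconv.integral_prod_left
  refine ae_eq_of_schwartz_integral_eq hG.locallyIntegrable hint.locallyIntegrable fun h => ?_
  -- This is the part of the test function that `χ` removes. It vanishes on the ball of radius `3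
  -- R`, so its convolution with `a` vanishes on the ball of radius `2 R`, and `T` kills the
  -- corresponding product.
  set b : 𝓢(EuclideanSpace ℝ (Fin n), ℂ) := 𝓕⁻ h - schwartzMul χ (𝓕⁻ h) with hb
  have hzero : T (schwartzMul (𝓕 a) (𝓕 b)) = 0 := by
    refine hT _ fun ξ hξ => ?_
    rw [fourierInv_schwartzMul_fourier_apply]
    refine integral_eq_zero_of_ae (Filter.Eventually.of_forall fun y => ?_)
    by_cases hy : R ≤ ‖y‖
    · simp [ha y hy]
    · have : ‖ξ - y‖ ≤ 3 * R := (norm_sub_le _ _).trans (by linarith)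
      simp [hb, hχ _ this]
  have hFb : 𝓕 b = h - 𝓕 (schwartzMul χ (𝓕⁻ h)) := by
    have := map_sub (fourierCLM ℂ 𝓢(EuclideanSpace ℝ (Fin n), ℂ)) (𝓕⁻ h)
      (schwartzMul χ (𝓕⁻ h))
    simpa using this
  have hval : T (schwartzMul (𝓕 a) h) =
      T (schwartzMul (𝓕 a) (𝓕 (schwartzMul χ (𝓕⁻ h)))) := by
    rw [← sub_eq_zero, ← map_sub, ← hzero]
    congr 1
    ext x
    simp [hFb]
    ring
  rw [(hg _).2, (hg _).2] at hval
  calc ∫ x, h x * (𝓕 a x * g x) = ∫ x, schwartzMul (𝓕 a) h x * g x := by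
        congr 1; ext x; simp; ring
    _ = ∫ y, ∫ x, h x * (𝓕 χ (y - x) * (𝓕 a y * g y)) := by
        rw [hval]
        congr 1; ext y
        rw [schwartzMul_apply, fourier_schwartzMul_apply, FourierTransform.fourier_fourierInv_eq,
          ← integral_sub_left_eq_self _ volume y, mul_right_comm, ← integral_const_mul]
        congr 1; ext x
        simp; ring
    _ = ∫ x, ∫ y, h x * (𝓕 χ (y - x) * (𝓕 a y * g y)) := by
        refine integral_integral_swap ?_
        have hb := hconv.bdd_mul (f := fun p : EuclideanSpace ℝ (Fin n) × EuclideanSpace ℝ (Fin n)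
          => h p.1) (c := SchwartzMap.seminorm ℝ 0 0 h)
          (h.continuous.comp continuous_fst).aestronglyMeasurable
          (Filter.Eventually.of_forall fun p => norm_le_seminorm ℝ h p.1)
        refine hb.swap.congr (Filter.Eventually.of_forall fun p => ?_)
        simp [Function.uncurry]; ring_nf; simp
    _ = _ := by
        congr 1; ext x
        rw [integral_const_mul]

lemma integral_re_pos {χ : 𝓢(EuclideanSpace ℝ (Fin n), ℂ)}
    (hχ : ∀ x, ∃ t : ℝ, 0 ≤ t ∧ χ x = t) (h0 : χ 0 ≠ 0) : 0 < (∫ x, χ x).re := by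
  have h1 : (∫ x, χ x).re = ∫ x, (χ x).re := by
    have := (Complex.reCLM.integral_comp_comm χ.integrable (μ := volume))
    simpa using this.symm
  rw [h1, integral_pos_iff_support_of_nonneg]
  · refine (Continuous.isOpen_support (by fun_prop)).measure_pos volume ⟨0, ?_⟩
    obtain ⟨t, -, ht⟩ := hχ 0
    rw [Function.mem_support, ht, Complex.ofReal_re]
    rintro rfl
    simp [ht] at h0
  · intro x
    obtain ⟨t, ht, hx⟩ := hχ x
    simpa [hx] using ht
  · exact χ.integrable.re

/-- **Nikolskii's inequality** (Plancherel–Pólya) from `L^r` to `L^∞`, `0 < r < ∞`, for functions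
with spectrum in a ball of radius `2 R`, without any boundedness assumed. -/
theorem exists_eLpNorm_top_le {r : ℝ≥0∞} (hr : 0 < r) (hrt : r ≠ ⊤) :
    ∃ C : ℝ≥0, ∀ (R : ℝ) (T : 𝓢'(EuclideanSpace ℝ (Fin n), ℂ))
      (g : EuclideanSpace ℝ (Fin n) → ℂ), 0 < R → HasSpectrumInBall T (2 * R) →
        IsRepresentedBy T g →
        eLpNorm g ⊤ volume ≤ C * ENNReal.ofReal R ^ ((n : ℝ) * recip r) * eLpNorm g r volume := by
  obtain ⟨a, ha1, ha, hareal⟩ :=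
    exists_schwartz_cutoff (E := EuclideanSpace ℝ (Fin n)) (1 / 2) (by norm_num)
  obtain ⟨χ, hχ, -, -⟩ :=
    exists_schwartz_cutoff (E := EuclideanSpace ℝ (Fin n)) 3 (by norm_num)
  norm_num at ha
  set A : ℝ≥0∞ := ‖𝓕 a 0‖ₑ with hA
  have hA0 : A ≠ 0 := by
    have := integral_re_pos hareal (by simp [ha1 0 (by simp)])
    rw [hA, fourier_coe, Real.fourier_eq]
    intro h
    simp only [inner_zero_right, neg_zero, AddChar.map_zero_eq_one, one_smul, enorm_eq_zero] at h
    simp [h] at this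
  have hAt : A ≠ ⊤ := by simp [hA]
  set Ca : ℝ≥0 := Real.toNNReal (SchwartzMap.seminorm ℝ 0 0 (𝓕 a)) with hCa
  have hCa' : ∀ x, ‖𝓕 a x‖ₑ ≤ Ca := fun x => by
    rw [← ofReal_norm]
    exact ENNReal.ofReal_le_ofReal (norm_le_seminorm ℝ _ x)
  -- The added `1` keeps the kernel bound nonzero, as `eLpNormEssSup_le_of_reproducing` demands.
  set Ck : ℝ≥0 := Real.toNNReal (SchwartzMap.seminorm ℝ 0 0 (𝓕 χ)) + 1 with hCk
  have hCk' : ∀ x, ‖𝓕 χ x‖ₑ ≤ Ck := fun x => by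
    rw [← ofReal_norm]
    refine (ENNReal.ofReal_le_ofReal (norm_le_seminorm ℝ _ x)).trans ?_
    rw [hCk]; push_cast; exact le_self_add
  have hCk0 : (Ck : ℝ≥0∞) ≠ 0 := by simp [hCk]
  set J : ℝ≥0∞ := ∫⁻ x, ‖𝓕 χ x‖ₑ with hJ
  have hJt : J ≠ ⊤ := (𝓕 χ).integrable.2.ne
  have hCt : (J + 1) * (Ck : ℝ≥0∞) ^ recip r * Ca / A ≠ ⊤ := by
    refine ENNReal.div_ne_top (ENNReal.mul_ne_top (ENNReal.mul_ne_top (by simp [hJt]) ?_)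
      (by simp)) hA0
    exact (ENNReal.rpow_lt_top_of_nonneg (recip_nonneg r) (by simp)).ne
  refine ⟨((J + 1) * (Ck : ℝ≥0∞) ^ recip r * Ca / A).toNNReal, fun R T g hR hT hg => ?_⟩
  rw [ENNReal.coe_toNNReal hCt]
  set κ : ℝ≥0∞ := ENNReal.ofReal R ^ (n : ℝ) * Ck with hκ
  have hRn0 : ENNReal.ofReal R ^ (n : ℝ) ≠ 0 := by simp [hR]
  have hRnt : ENNReal.ofReal R ^ (n : ℝ) ≠ ⊤ := by simp
  have hK : ∀ x, 𝓕 (dilate (Units.mk0 R hR.ne')⁻¹ χ) x = ((R ^ n : ℝ) : ℂ) * 𝓕 χ (R • x) :=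
    fun x => by
      rw [fourier_dilate_apply]
      simp [abs_of_pos hR]
  have hKe : ∀ x, ‖𝓕 (dilate (Units.mk0 R hR.ne')⁻¹ χ) x‖ₑ
      = ENNReal.ofReal R ^ (n : ℝ) * ‖𝓕 χ (R • x)‖ₑ := fun x => by
    rw [hK, enorm_mul, ← ofReal_norm, Complex.norm_real, Real.norm_of_nonneg
      (by positivity), ENNReal.ofReal_pow hR.le, ENNReal.rpow_natCast]
  have hKint : ∫⁻ x, ‖𝓕 (dilate (Units.mk0 R hR.ne')⁻¹ χ) x‖ₑ = J := by
    simp_rw [hKe]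
    rw [lintegral_const_mul' _ _ hRnt]
    have := eLpNorm_comp_smul (𝓕 χ).continuous.stronglyMeasurable 1 hR
    rw [eLpNorm_one_eq_lintegral_enorm, eLpNorm_one_eq_lintegral_enorm] at this
    rw [this, ← mul_assoc, ← hJ]
    simp only [finrank_euclideanSpace, Fintype.card_fin, recip, inv_one, ENNReal.toReal_one,
      mul_one]
    rw [← ENNReal.rpow_add _ _ (by simpa using hR) (by simp)]
    simp
  set B : ℝ≥0∞ := (J + 1) * κ ^ recip r * (Ca * eLpNorm g r volume) with hB
  -- The multiplier `𝓕 a (ε x)` with `ε = R / (m + 1) ≤ R` regularizes `g` while `b`, its inverse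
  -- Fourier transform, stays supported in the ball of radius `R`. The bound does not depend on `m`,
  -- so `m → ∞` replaces the multiplier by the nonzero constant `𝓕 a 0`.
  have hbound : ∀ m : ℕ, ∀ᵐ x, ‖𝓕 a ((R / (m + 1)) • x)‖ₑ * ‖g x‖ₑ ≤ B := by
    intro m
    have hε : 0 < R / (m + 1) := by positivity
    set ε := R / ((m : ℝ) + 1) with hεd
    have hεR : ε ≤ R := div_le_self hR.le (by linarith [(Nat.cast_nonneg m : (0:ℝ) ≤ m)])
    set b : 𝓢(EuclideanSpace ℝ (Fin n), ℂ) :=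
      (((ε ^ n)⁻¹ : ℝ) : ℂ) • dilate (Units.mk0 ε hε.ne')⁻¹ a with hb
    have hb0 : ∀ ξ, R ≤ ‖ξ‖ → b ξ = 0 := fun ξ hξ => by
      have : a (ε⁻¹ • ξ) = 0 := by
        refine ha _ ?_
        rw [norm_smul, norm_inv, Real.norm_of_nonneg hε.le, inv_mul_eq_div, le_div_iff₀ hε]
        linarith
      simp [hb, this]
    have hFb : ∀ x, 𝓕 b x = 𝓕 a (ε • x) := fun x => by
      rw [hb, FourierTransform.fourier_smul, smul_apply, fourier_dilate_apply]
      have : (ε : ℂ) ^ n ≠ 0 := by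
        rw [← Complex.ofReal_pow, Complex.ofReal_ne_zero]; positivity
      simp [abs_of_pos hε, this]
    have hrep := hT.ae_reproducing hg (a := b) (χ := dilate (Units.mk0 R hR.ne')⁻¹ χ) hb0
      (fun ξ hξ => by
        rw [dilate_apply]
        refine hχ _ ?_
        rw [norm_smul]
        simp only [Units.val_inv_eq_inv_val, Units.val_mk0, norm_inv, Real.norm_of_nonneg hR.le]
        rw [inv_mul_eq_div, div_le_iff₀ hR]; exact hξ)
    have hmain := eLpNormEssSup_le_of_reproducing (μ := volume) (κ := κ) (J := J) (r := r)
      (hg (𝓕 b)).1 (mul_ne_zero hRn0 hCk0) (ENNReal.mul_ne_top hRnt (by simp))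
      (K := fun x y => 𝓕 (dilate (Units.mk0 R hR.ne')⁻¹ χ) (y - x))
      (fun x y => by rw [hKe]; exact mul_le_mul_right (hCk' _) _)
      (fun x => by
        rw [lintegral_sub_right_eq_self
          (fun y => ‖𝓕 (dilate (Units.mk0 R hR.ne')⁻¹ χ) y‖ₑ) x, hKint])
      hrep (fun x => by
        refine Continuous.aestronglyMeasurable ?_
        exact (𝓕 (dilate (Units.mk0 R hR.ne')⁻¹ χ)).continuous.comp (by fun_prop)) hr hrt
    have hle : eLpNorm (fun x => 𝓕 b x * g x) r volume ≤ Ca * eLpNorm g r volume := by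
      have := eLpNorm_le_nnreal_smul_eLpNorm_of_ae_le_mul (p := r) (μ := volume) (c := Ca)
        (f := fun x => 𝓕 b x * g x) (g := g) (Filter.Eventually.of_forall fun x => by
          rw [nnnorm_mul]
          gcongr
          have := hCa' (ε • x)
          rw [← hFb x, enorm_eq_nnnorm] at this
          exact_mod_cast this)
      simpa [ENNReal.smul_def] using this
    filter_upwards [ae_le_eLpNormEssSup (f := fun x => 𝓕 b x * g x) (μ := volume)] with x hx
    rw [← hFb, ← enorm_mul]
    exact (hx.trans hmain).trans (by rw [hB]; gcongr)
  have hlim : ∀ᵐ x, A * ‖g x‖ₑ ≤ B := by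
    filter_upwards [ae_all_iff.2 hbound] with x hx
    have h1 : Filter.Tendsto (fun m : ℕ => (R / ((m : ℝ) + 1)) • x) Filter.atTop (nhds 0) := by
      have := (tendsto_const_div_atTop_nhds_zero_nat R).comp (Filter.tendsto_add_atTop_nat 1)
      have := this.smul_const x
      simpa using this
    have h2 : Filter.Tendsto (fun m : ℕ => ‖𝓕 a ((R / ((m : ℝ) + 1)) • x)‖ₑ * ‖g x‖ₑ)
        Filter.atTop (nhds (A * ‖g x‖ₑ)) := by
      refine ENNReal.Tendsto.mul_const ?_ (Or.inr (by simp))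
      exact ((continuous_enorm.comp (𝓕 a).continuous).tendsto 0).comp h1
    exact le_of_tendsto' h2 hx
  rw [eLpNorm_exponent_top]
  refine eLpNormEssSup_le_of_ae_enorm_bound ?_
  filter_upwards [hlim] with x hx
  have hx' : ‖g x‖ₑ ≤ A⁻¹ * B := (ENNReal.mul_le_iff_le_inv hA0 hAt).1 hx
  refine hx'.trans_eq ?_
  rw [hB, hκ, ENNReal.mul_rpow_of_nonneg _ _ (recip_nonneg r), ← ENNReal.rpow_mul,
    ENNReal.div_eq_inv_mul]
  ring

/-- **Nikolskii's inequality** from `L^r` to `L^p`, `0 < r ≤ p ≤ ∞`. -/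
theorem exists_eLpNorm_le_of_recip_le {p r : ℝ≥0∞} (hp : 0 < p) (hr : 0 < r)
    (h : recip p ≤ recip r) :
    ∃ C : ℝ≥0, ∀ (R : ℝ) (T : 𝓢'(EuclideanSpace ℝ (Fin n), ℂ))
      (g : EuclideanSpace ℝ (Fin n) → ℂ), 0 < R → HasSpectrumInBall T (2 * R) →
        IsRepresentedBy T g →
        eLpNorm g p volume ≤
          C * ENNReal.ofReal R ^ ((n : ℝ) * (recip r - recip p)) * eLpNorm g r volume := by
  by_cases hrt : r = ⊤
  · have : p = r := recip_injective hp hr (le_antisymm h (by simp [hrt, recip_nonneg]))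
    subst this
    exact ⟨1, fun R T g _ _ _ => by simp⟩
  obtain ⟨C, hC⟩ := exists_eLpNorm_top_le (n := n) hr hrt
  have hr' := recip_pos hr hrt
  -- `L^p` lies between `L^r` and `L^∞` with this weight on `L^∞`.
  set τ := 1 - recip p / recip r with hτ
  have hτ0 : 0 ≤ τ := by rw [hτ, sub_nonneg]; exact div_le_one_of_le₀ h hr'.le
  have hτ1 : τ ≤ 1 := by
    rw [hτ]; have := div_nonneg (recip_nonneg p) hr'.le; linarith
  refine ⟨C ^ τ, fun R T g hR hT hg => ?_⟩
  have hm : AEMeasurable (fun x => ‖g x‖ₑ) volume :=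
    hg.locallyIntegrable.aestronglyMeasurable.enorm
  have hint := eLpNorm_le_of_recip_eq (f := fun x => ‖g x‖ₑ) hm hm hp hr
    (by simp : (0 : ℝ≥0∞) < ⊤) hτ0 hτ1 (by rw [hτ]; simp; field_simp)
    (Filter.Eventually.of_forall fun x => by
      rw [← ENNReal.rpow_add_of_nonneg _ _ (by linarith) hτ0]; simp)
  simp only [eLpNorm_enorm] at hint
  refine hint.trans ?_
  calc eLpNorm g r volume ^ (1 - τ) * eLpNorm g ⊤ volume ^ τ
      ≤ eLpNorm g r volume ^ (1 - τ) *
        (C * ENNReal.ofReal R ^ ((n : ℝ) * recip r) * eLpNorm g r volume) ^ τ := by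
        gcongr
        exact hC R T g hR hT hg
    _ = (C : ℝ≥0∞) ^ τ * ENNReal.ofReal R ^ ((n : ℝ) * recip r * τ) *
        (eLpNorm g r volume ^ (1 - τ) * eLpNorm g r volume ^ τ) := by
        rw [ENNReal.mul_rpow_of_nonneg _ _ hτ0, ENNReal.mul_rpow_of_nonneg _ _ hτ0,
          ← ENNReal.rpow_mul]
        ring
    _ = _ := by
        rw [← ENNReal.rpow_add_of_nonneg _ _ (by linarith) hτ0, sub_add_cancel, ENNReal.rpow_one,
          ENNReal.coe_rpow_of_nonneg _ hτ0]
        congr 3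
        rw [hτ]; field_simp

end Nikolskii

/-! ### The conditions imply the inequality. -/

section Sufficiency

variable {n : ℕ} {ψ : EuclideanSpace ℝ (Fin n) → ℝ} {p p₀ p₁ q q₀ q₁ : ℝ≥0∞} {s s₀ s₁ θ : ℝ}

lemma le_besovNorm (hq : 0 < q) (u : 𝓢'(EuclideanSpace ℝ (Fin n), ℂ)) (k : ℤ) :
    (2 : ℝ≥0∞) ^ ((k : ℝ) * s) * distLpNorm p (block ψ k u) ≤ besovNorm ψ s p q u :=
  le_seqNorm hq (fun k : ℤ => (2 : ℝ≥0∞) ^ ((k : ℝ) * s) * distLpNorm p (block ψ k u)) k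

lemma exists_isRepresentedBy_block (hq : 0 < q) {u : 𝓢'(EuclideanSpace ℝ (Fin n), ℂ)}
    (hu : u ∈ besovSpace ψ s p q) (k : ℤ) : ∃ g, IsRepresentedBy (block ψ k u) g := by
  refine exists_isRepresentedBy_of_distLpNorm_lt_top (p := p) ?_
  have h := (le_besovNorm (ψ := ψ) (s := s) (p := p) hq u k).trans_lt hu
  by_contra h'
  rw [not_lt, top_le_iff] at h'
  rw [h', ENNReal.mul_top (two_rpow_ne_zero _)] at h
  exact lt_irrefl _ h

/-- Blockwise interpolation between two Besov scales, with a Nikolskii loss. -/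
lemma exists_block_le (hψ : IsCutoff ψ) (hp : 0 < p) (hp₀ : 0 < p₀) (hp₁ : 0 < p₁) (hq₀ : 0 < q₀)
    {τ : ℝ} (hτ₀ : 0 ≤ τ) (hτ₁ : τ ≤ 1)
    (h : recip p ≤ (1 - τ) * recip p₀ + τ * recip p₁) :
    ∃ C : ℝ≥0, ∀ u ∈ besovSpace ψ s₀ p₀ q₀, ∀ k : ℤ,
      (2 : ℝ≥0∞) ^ ((k : ℝ) * s) * distLpNorm p (block ψ k u) ≤
        C * 2 ^ ((k : ℝ) * (((1 - τ) * (n * recip p₀ - s₀) + τ * (n * recip p₁ - s₁)) -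
            (n * recip p - s))) *
          ((2 ^ ((k : ℝ) * s₀) * distLpNorm p₀ (block ψ k u)) ^ (1 - τ) *
            (2 ^ ((k : ℝ) * s₁) * distLpNorm p₁ (block ψ k u)) ^ τ) := by
  -- Hölder lands in this `L^r`; the hypothesis on `p` says `r ≤ p`, so Nikolskii goes from `L^r` to
  -- `L^p`.
  obtain ⟨r, hr, hr'⟩ := exists_recip_eq ((recip_nonneg p).trans h)
  obtain ⟨C, hC⟩ := exists_eLpNorm_le_of_recip_le (n := n) hp hr (h.trans_eq hr'.symm)
  refine ⟨C, fun u hu k => ?_⟩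
  obtain ⟨g, hg⟩ := exists_isRepresentedBy_block hq₀ hu k
  rw [hg.distLpNorm_eq, hg.distLpNorm_eq, hg.distLpNorm_eq]
  have hm : AEMeasurable (fun x => ‖g x‖ₑ) volume :=
    hg.locallyIntegrable.aestronglyMeasurable.enorm
  have hint := eLpNorm_le_of_recip_eq (f := fun x => ‖g x‖ₑ) hm hm hr hp₀ hp₁ hτ₀ hτ₁ hr'
    (Filter.Eventually.of_forall fun x => by
      rw [← ENNReal.rpow_add_of_nonneg _ _ (by linarith) hτ₀]; simp)
  simp only [eLpNorm_enorm] at hint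
  have hnik := hC (2 ^ k) (block ψ k u) g (by positivity) (hψ.hasSpectrumInBall_block k u) hg
  have h2k : ENNReal.ofReal ((2 : ℝ) ^ k) = 2 ^ (k : ℝ) := by
    rw [← Real.rpow_intCast, ← ENNReal.ofReal_rpow_of_pos (by norm_num)]; simp
  rw [h2k, ← ENNReal.rpow_mul] at hnik
  have h1τ : 0 ≤ 1 - τ := by linarith
  calc _ ≤ 2 ^ ((k : ℝ) * s) * (C * 2 ^ ((k : ℝ) * (n * (recip r - recip p))) *
        (eLpNorm g p₀ volume ^ (1 - τ) * eLpNorm g p₁ volume ^ τ)) := by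
        gcongr
        exact hnik.trans (by gcongr)
    _ = C * (2 ^ ((k : ℝ) * s) * 2 ^ ((k : ℝ) * (n * (recip r - recip p)))) *
        (eLpNorm g p₀ volume ^ (1 - τ) * eLpNorm g p₁ volume ^ τ) := by ring
    _ = C * (2 ^ ((k : ℝ) * (((1 - τ) * (n * recip p₀ - s₀) + τ * (n * recip p₁ - s₁)) -
            (n * recip p - s))) * (2 ^ ((k : ℝ) * s₀ * (1 - τ)) * 2 ^ ((k : ℝ) * s₁ * τ))) *
        (eLpNorm g p₀ volume ^ (1 - τ) * eLpNorm g p₁ volume ^ τ) := by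
        rw [← two_rpow_add, ← two_rpow_add, ← two_rpow_add, hr']
        congr 3; ring
    _ = _ := by
        rw [ENNReal.mul_rpow_of_nonneg _ _ h1τ, ENNReal.mul_rpow_of_nonneg _ _ hτ₀,
          ← ENNReal.rpow_mul, ← ENNReal.rpow_mul]
        ring

/-- The multiplicative inequality when the summability exponents are compatible. -/
lemma exists_besovNorm_le_of_recip_le (hψ : IsCutoff ψ) (hp : 0 < p) (hp₀ : 0 < p₀) (hp₁ : 0 < p₁)
    (hq : 0 < q) (hq₀ : 0 < q₀) (hq₁ : 0 < q₁) (hθ₀ : 0 ≤ θ) (hθ₁ : θ ≤ 1)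
    (hscale : (n : ℝ) * recip p - s =
      (1 - θ) * ((n : ℝ) * recip p₀ - s₀) + θ * ((n : ℝ) * recip p₁ - s₁))
    (h : recip p ≤ (1 - θ) * recip p₀ + θ * recip p₁)
    (hqq : recip q ≤ (1 - θ) * recip q₀ + θ * recip q₁) :
    ∃ C : ℝ≥0, ∀ u ∈ besovSpace ψ s₀ p₀ q₀,
      besovNorm ψ s p q u ≤
        C * besovNorm ψ s₀ p₀ q₀ u ^ (1 - θ) * besovNorm ψ s₁ p₁ q₁ u ^ θ := by
  obtain ⟨C, hC⟩ := exists_block_le (s := s) (s₀ := s₀) (s₁ := s₁) hψ hp hp₀ hp₁ hq₀ hθ₀ hθ₁ h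
  refine ⟨C, fun u hu => (seqNorm_mono (hC u hu)).trans ?_⟩
  rw [← hscale, sub_self]
  simp only [mul_zero, ENNReal.rpow_zero, mul_one]
  rw [seqNorm_const_mul hq, mul_assoc]
  gcongr
  exact seqNorm_rpow_mul_rpow_le hq hq₀ hq₁ hθ₀ hθ₁ hqq _ _

lemma exists_eq_two_rpow {x : ℝ≥0∞} (h0 : x ≠ 0) (ht : x ≠ ⊤) : ∃ t : ℝ, x = 2 ^ t := by
  have hx := ENNReal.toReal_pos h0 ht
  refine ⟨Real.logb 2 x.toReal, ?_⟩
  have h2 : (2 : ℝ≥0∞) = ENNReal.ofReal 2 := by simp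
  rw [h2, ENNReal.ofReal_rpow_of_pos (by norm_num),
    Real.rpow_logb (by norm_num) (by norm_num) hx, ENNReal.ofReal_toReal ht]

/-- The multiplicative inequality without restriction on the summability exponents, when the two
scales have different homogeneity. -/
lemma exists_besovNorm_le_of_ne (hψ : IsCutoff ψ) (hp : 0 < p) (hp₀ : 0 < p₀) (hp₁ : 0 < p₁)
    (hq : 0 < q) (hq₀ : 0 < q₀) (hq₁ : 0 < q₁) {δ : ℝ} (hδ : 0 < δ) (hδ₀ : δ ≤ θ)
    (hδ₁ : δ ≤ 1 - θ) (hθ₀ : 0 < θ) (hθ₁ : θ < 1)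
    (hscale : (n : ℝ) * recip p - s =
      (1 - θ) * ((n : ℝ) * recip p₀ - s₀) + θ * ((n : ℝ) * recip p₁ - s₁))
    (hD : (n : ℝ) * recip p₁ - s₁ ≠ (n : ℝ) * recip p₀ - s₀)
    (h : recip p ≤ (1 - θ) * recip p₀ + θ * recip p₁)
    (hplus : recip p ≤ (1 - (θ + δ)) * recip p₀ + (θ + δ) * recip p₁)
    (hminus : recip p ≤ (1 - (θ - δ)) * recip p₀ + (θ - δ) * recip p₁) :
    ∃ C : ℝ≥0, ∀ u ∈ besovSpace ψ s₀ p₀ q₀ ∩ besovSpace ψ s₁ p₁ q₁,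
      besovNorm ψ s p q u ≤
        C * besovNorm ψ s₀ p₀ q₀ u ^ (1 - θ) * besovNorm ψ s₁ p₁ q₁ u ^ θ := by
  obtain ⟨C, hC⟩ := exists_block_le (s := s) (s₀ := s₀) (s₁ := s₁) hψ hp hp₀ hp₁ hq₀ hθ₀.le
    hθ₁.le h
  obtain ⟨C₁, hC₁⟩ := exists_block_le (s := s) (s₀ := s₀) (s₁ := s₁) hψ hp hp₀ hp₁ hq₀
    (by linarith) (by linarith) hplus
  obtain ⟨C₂, hC₂⟩ := exists_block_le (s := s) (s₀ := s₀) (s₁ := s₁) hψ hp hp₀ hp₁ hq₀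
    (by linarith) (by linarith) hminus
  set D := ((n : ℝ) * recip p₁ - s₁) - ((n : ℝ) * recip p₀ - s₀) with hDdef
  have hD0 : δ * D ≠ 0 := mul_ne_zero hδ.ne' (sub_ne_zero.2 hD)
  obtain ⟨G, hG⟩ := exists_seqNorm_le_of_two_sided hq hD0
  -- By the scaling identity the exponent of `2^k` vanishes at `τ = θ` and is affine in `τ` with
  -- slope `D`; at `θ ± δ` it is `± δ D`.
  have e₁ : ((1 - (θ + δ)) * ((n : ℝ) * recip p₀ - s₀) + (θ + δ) * (n * recip p₁ - s₁)) -
      (n * recip p - s) = δ * D := by rw [hscale, hDdef]; ring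
  have e₂ : ((1 - (θ - δ)) * ((n : ℝ) * recip p₀ - s₀) + (θ - δ) * (n * recip p₁ - s₁)) -
      (n * recip p - s) = -(δ * D) := by rw [hscale, hDdef]; ring
  rw [e₁] at hC₁
  rw [e₂] at hC₂
  refine ⟨G * (C₁ + C₂), fun u hu => ?_⟩
  have hb := le_besovNorm (ψ := ψ) (s := s₀) (p := p₀) hq₀ u
  have hc := le_besovNorm (ψ := ψ) (s := s₁) (p := p₁) hq₁ u
  have hA₀t : besovNorm ψ s₀ p₀ q₀ u ≠ ⊤ := hu.1.ne
  have hA₁t : besovNorm ψ s₁ p₁ q₁ u ≠ ⊤ := hu.2.ne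
  set A₀ := besovNorm ψ s₀ p₀ q₀ u
  set A₁ := besovNorm ψ s₁ p₁ q₁ u
  -- If a norm vanishes, so does every block, since both `θ` and `1 - θ` are positive. Otherwise
  -- both norms are powers of `2`, and their ratio only shifts the crossing point of the two
  -- progressions.
  by_cases hA : A₀ = 0 ∨ A₁ = 0
  · have hz : ∀ k : ℤ, (2 : ℝ≥0∞) ^ ((k : ℝ) * s) * distLpNorm p (block ψ k u) = 0 := fun k => by
      have := hC u hu.1 k
      rcases hA with hA | hA
      · have h0 : (2 : ℝ≥0∞) ^ ((k : ℝ) * s₀) * distLpNorm p₀ (block ψ k u) = 0 :=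
          le_antisymm ((hb k).trans_eq hA) zero_le
        rw [h0, ENNReal.zero_rpow_of_pos (by linarith), zero_mul, mul_zero] at this
        exact le_antisymm this zero_le
      · have h0 : (2 : ℝ≥0∞) ^ ((k : ℝ) * s₁) * distLpNorm p₁ (block ψ k u) = 0 :=
          le_antisymm ((hc k).trans_eq hA) zero_le
        rw [h0, ENNReal.zero_rpow_of_pos (by linarith), mul_zero, mul_zero] at this
        exact le_antisymm this zero_le
    refine le_trans (seqNorm_le_of_support hq ∅ (A := 0) (by simp) fun k _ => hz k) (by simp)
  · rw [not_or] at hA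
    obtain ⟨x₀, hx₀⟩ := exists_eq_two_rpow hA.1 hA₀t
    obtain ⟨x₁, hx₁⟩ := exists_eq_two_rpow hA.2 hA₁t
    have main := hG (fun k : ℤ => (2 : ℝ≥0∞) ^ ((k : ℝ) * s) * distLpNorm p (block ψ k u))
      ((C₁ + C₂) * (A₀ ^ (1 - θ) * A₁ ^ θ)) (δ * (x₁ - x₀)) (fun k => ?_) (fun k => ?_)
    · refine main.trans_eq ?_
      push_cast; ring
    · refine (hC₁ u hu.1 k).trans ?_
      calc _ ≤ (C₁ + C₂) * (2 : ℝ≥0∞) ^ ((k : ℝ) * (δ * D)) *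
            (A₀ ^ (1 - (θ + δ)) * A₁ ^ (θ + δ)) := by
            gcongr
            · exact le_self_add
            · linarith
            · exact hb k
            · exact hc k
        _ = _ := by
            rw [hx₀, hx₁]
            simp only [← ENNReal.rpow_mul]
            rw [mul_assoc, mul_assoc, ← two_rpow_add, ← two_rpow_add, ← two_rpow_add,
              ← two_rpow_add]
            congr 2; ring
    · refine (hC₂ u hu.1 k).trans ?_
      calc _ ≤ (C₁ + C₂) * (2 : ℝ≥0∞) ^ ((k : ℝ) * -(δ * D)) *
            (A₀ ^ (1 - (θ - δ)) * A₁ ^ (θ - δ)) := by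
            gcongr
            · exact le_add_self
            · linarith
            · exact hb k
            · exact hc k
        _ = _ := by
            rw [hx₀, hx₁]
            simp only [← ENNReal.rpow_mul]
            rw [mul_assoc, mul_assoc, ← two_rpow_add, ← two_rpow_add, ← two_rpow_add,
              ← two_rpow_add]
            congr 2; ring

theorem exists_besovNorm_le (hn : 1 ≤ n) (hψ : IsCutoff ψ) (hp : 0 < p) (hp₀ : 0 < p₀)
    (hp₁ : 0 < p₁) (hq : 0 < q) (hq₀ : 0 < q₀) (hq₁ : 0 < q₁) (hθ₀ : 0 ≤ θ) (hθ₁ : θ ≤ 1)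
    (hscale : (n : ℝ) * recip p - s =
      (1 - θ) * ((n : ℝ) * recip p₀ - s₀) + θ * ((n : ℝ) * recip p₁ - s₁))
    (hs : s ≤ (1 - θ) * s₀ + θ * s₁)
    (hne : p₀ ≠ p₁ ∧ s = (1 - θ) * s₀ + θ * s₁ →
      recip q ≤ (1 - θ) * recip q₀ + θ * recip q₁)
    (heq : p₀ = p₁ ∧ s = (1 - θ) * s₀ + θ * s₁ →
      ((0 < θ ∧ θ < 1) ∧ s₀ ≠ s₁) ∨ recip q ≤ (1 - θ) * recip q₀ + θ * recip q₁)
    (hlt : s < (1 - θ) * s₀ + θ * s₁ →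
      ((0 < θ ∧ θ < 1) ∧ s₀ - (n : ℝ) * recip p₀ ≠ s - (n : ℝ) * recip p) ∨
        recip q ≤ (1 - θ) * recip q₀ + θ * recip q₁) :
    ∃ C : ℝ≥0, ∀ u ∈ besovSpace ψ s₀ p₀ q₀ ∩ besovSpace ψ s₁ p₁ q₁,
      besovNorm ψ s p q u ≤
        C * besovNorm ψ s₀ p₀ q₀ u ^ (1 - θ) * besovNorm ψ s₁ p₁ q₁ u ^ θ := by
  have hn' : (0 : ℝ) < n := by exact_mod_cast hn
  have hgap : (n : ℝ) * ((1 - θ) * recip p₀ + θ * recip p₁ - recip p) =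
      (1 - θ) * s₀ + θ * s₁ - s := by linarith
  have hp' : recip p ≤ (1 - θ) * recip p₀ + θ * recip p₁ := by
    by_contra! h
    have := mul_neg_of_pos_of_neg hn' (sub_neg.2 h)
    linarith
  by_cases hqq : recip q ≤ (1 - θ) * recip q₀ + θ * recip q₁
  · obtain ⟨C, hC⟩ := exists_besovNorm_le_of_recip_le hψ hp hp₀ hp₁ hq hq₀ hq₁ hθ₀ hθ₁ hscale hp'
      hqq
    exact ⟨C, fun u hu => hC u hu.1⟩
  rcases hs.lt_or_eq with hs | hs
  · obtain ⟨⟨h0, h1⟩, hD⟩ := (hlt hs).resolve_right hqq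
    set g := (1 - θ) * recip p₀ + θ * recip p₁ - recip p with hg
    have hgpos : 0 < g := by
      by_contra! h
      have := mul_nonpos_of_nonneg_of_nonpos hn'.le h
      linarith
    set L := |recip p₁ - recip p₀| + 1 with hL
    have hLpos : 0 < L := by positivity
    -- There is a gap `g > 0` in the integrability exponents. Moving `τ` by `δ` changes the
    -- interpolated exponent by at most `δ * L ≤ g`, so Nikolskii still applies at `θ ± δ`; the `1`
    -- in `L` avoids division by zero.
    set δ := min (min θ (1 - θ)) (g / L) with hδ
    have hδpos : 0 < δ := lt_min (lt_min h0 (by linarith)) (by positivity)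
    have hδL : δ * L ≤ g := by
      rw [← le_div_iff₀ hLpos]; exact min_le_right _ _
    have hb1 : δ * (recip p₁ - recip p₀) ≤ δ * L :=
      mul_le_mul_of_nonneg_left ((le_abs_self _).trans (by linarith)) hδpos.le
    have hb2 : δ * -(recip p₁ - recip p₀) ≤ δ * L :=
      mul_le_mul_of_nonneg_left ((neg_le_abs _).trans (by linarith)) hδpos.le
    refine exists_besovNorm_le_of_ne hψ hp hp₀ hp₁ hq hq₀ hq₁ hδpos
      ((min_le_left _ _).trans (min_le_left _ _)) ((min_le_left _ _).trans (min_le_right _ _))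
      h0 h1 hscale (fun hD' => hD ?_) hp' (by linarith) (by linarith)
    rw [hD'] at hscale; linarith
  · by_cases hpp : p₀ = p₁
    · obtain ⟨⟨h0, h1⟩, hD⟩ := (heq ⟨hpp, hs⟩).resolve_right hqq
      subst hpp
      have hp'' : recip p ≤ recip p₀ := by linarith
      -- With `p₀ = p₁` the interpolated exponent does not depend on `τ`, so `δ` is limited only by
      -- `θ ± δ ∈ [0, 1]`.
      refine exists_besovNorm_le_of_ne hψ hp hp₀ hp₁ hq hq₀ hq₁ (δ := min θ (1 - θ))
        (lt_min h0 (by linarith)) (min_le_left _ _) (min_le_right _ _)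
        h0 h1 hscale (fun hD' => hD (by linarith)) hp' (by linarith) (by linarith)
    · exact absurd (hne ⟨hpp, hs⟩) hqq

end Sufficiency

/-! ### Polynomial decay of Schwartz functions. -/

section Decay

variable {E : Type*} [NormedAddCommGroup E] [InnerProductSpace ℝ E]

lemma exists_schwartz_norm_le (f : 𝓢(E, ℂ)) (M : ℕ) :
    ∃ B : ℝ, 0 < B ∧ ∀ x, ‖f x‖ ≤ B * ((1 + ‖x‖) ^ M)⁻¹ := by
  refine ⟨2 ^ M * (Finset.Iic (M, 0)).sup (fun m => SchwartzMap.seminorm ℝ m.1 m.2) f + 1,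
    by positivity, fun x => ?_⟩
  have := SchwartzMap.one_add_le_sup_seminorm_apply (𝕜 := ℝ) (m := (M, 0)) (k := M) (n := 0) le_rfl
    le_rfl f x
  rw [norm_iteratedFDeriv_zero] at this
  rw [← div_eq_mul_inv, le_div_iff₀ (by positivity)]
  linarith

variable [FiniteDimensional ℝ E] [MeasurableSpace E] [BorelSpace E]

lemma integrable_norm_mul_one_add_pow (f : 𝓢(E, ℂ)) (M : ℕ) :
    Integrable (fun x => ‖f x‖ * (1 + ‖x‖) ^ M) := by
  obtain ⟨B, hB, h⟩ := exists_schwartz_norm_le f (M + (Module.finrank ℝ E + 1))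
  have hint := (integrable_one_add_norm (E := E) (μ := volume)
    (r := (Module.finrank ℝ E + 1 : ℕ)) (by push_cast; linarith)).const_mul B
  refine hint.mono' (Continuous.aestronglyMeasurable (by fun_prop))
    (Filter.Eventually.of_forall fun x => ?_)
  rw [Real.norm_of_nonneg (by positivity), Real.rpow_neg (by positivity), Real.rpow_natCast]
  have hx : (0 : ℝ) < 1 + ‖x‖ := by positivity
  calc ‖f x‖ * (1 + ‖x‖) ^ M
      ≤ (B * ((1 + ‖x‖) ^ (M + (Module.finrank ℝ E + 1)))⁻¹) * (1 + ‖x‖) ^ M := by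
        gcongr; exact h x
    _ = _ := by rw [pow_add]; field_simp

lemma exists_eLpNorm_inv_one_add_pow_lt_top {p : ℝ≥0∞} (hp : 0 < p) :
    ∃ M : ℕ, eLpNorm (fun x : E => ((1 + ‖x‖) ^ M)⁻¹) p volume < ⊤ := by
  by_cases ht : p = ⊤
  · subst ht
    refine ⟨0, (eLpNormEssSup_le_of_ae_enorm_bound (C := 1) ?_).trans_lt ENNReal.one_lt_top⟩
    simp
  have hP := ENNReal.toReal_pos hp.ne' ht
  obtain ⟨M, hM⟩ := exists_nat_gt ((Module.finrank ℝ E : ℝ) / p.toReal)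
  rw [div_lt_iff₀ hP] at hM
  refine ⟨M, ?_⟩
  rw [eLpNorm_lt_top_iff_lintegral_rpow_enorm_lt_top hp.ne' ht]
  have := finite_integral_one_add_norm (E := E) (μ := volume) hM
  refine lt_of_le_of_lt (lintegral_mono fun x => ?_) this
  rw [← ofReal_norm, ENNReal.ofReal_rpow_of_nonneg (by positivity) hP.le,
    Real.norm_of_nonneg (by positivity), Real.rpow_neg (by positivity), Real.rpow_mul
    (by positivity), Real.rpow_natCast, Real.inv_rpow (by positivity)]

end Decay

/-! ### Pointwise bounds for frequency-localized wave packets. -/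

section Wavelet

open FourierTransform SchwartzMap

variable {n : ℕ} {ψ : EuclideanSpace ℝ (Fin n) → ℝ}

local notation "𝔼" => EuclideanSpace ℝ (Fin n)

/-- The Fourier transform of a wave packet of frequency `ζ` and spatial width `1 / μ`. -/
noncomputable def packet (ρ : 𝓢(EuclideanSpace ℝ (Fin n), ℂ)) (ζ : EuclideanSpace ℝ (Fin n))
    (μ : ℝˣ) : 𝓢(EuclideanSpace ℝ (Fin n), ℂ) :=
  (((μ : ℝ) ^ n)⁻¹ : ℂ) • compSubConstCLM ℂ ζ (dilate μ⁻¹ ρ)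

lemma packet_apply (ρ : 𝓢(𝔼, ℂ)) (ζ : 𝔼) (μ : ℝˣ) (ξ : 𝔼) :
    packet ρ ζ μ ξ = (((μ : ℝ) ^ n)⁻¹ : ℂ) * ρ ((μ : ℝ)⁻¹ • (ξ - ζ)) := by
  simp [packet]

/-- The factor `μ^{-n}` in `packet` cancels the Jacobian of the dilation, so the height of the
packet does not depend on its width. -/
lemma fourierInv_packet_apply (ρ : 𝓢(𝔼, ℂ)) (ζ : 𝔼) {μ : ℝˣ} (hμ : 0 < (μ : ℝ)) (x : 𝔼) :
    𝓕⁻ (packet ρ ζ μ) x = Real.fourierChar (inner ℝ ζ x) • 𝓕⁻ ρ ((μ : ℝ) • x) := by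
  have h1 : 𝓕⁻ (compSubConstCLM ℂ ζ (dilate μ⁻¹ ρ)) x =
      Real.fourierChar (inner ℝ ζ x) • 𝓕⁻ (dilate μ⁻¹ ρ) x := by
    rw [fourierInv_coe, fourierInv_coe, Real.fourierInv_eq, Real.fourierInv_eq,
      ← integral_add_right_eq_self _ ζ, Circle.smul_def, ← integral_smul]
    congr 1
    ext v
    rw [compSubConstCLM_apply, add_sub_cancel_right, inner_add_left, add_comm (inner ℝ v x),
      AddChar.map_add_eq_mul, mul_smul, ← Circle.smul_def]
  rw [packet, FourierTransform.fourierInv_smul, smul_apply, h1, fourierInv_dilate_apply]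
  have : (((μ : ℝ) : ℂ) ^ n) ≠ 0 := by simp
  simp [abs_of_pos hμ, Circle.smul_def]
  field_simp

lemma norm_fourierInv_packet_apply (ρ : 𝓢(𝔼, ℂ)) (ζ : 𝔼) {μ : ℝˣ} (hμ : 0 < (μ : ℝ)) (x : 𝔼) :
    ‖𝓕⁻ (packet ρ ζ μ) x‖ = ‖𝓕⁻ ρ ((μ : ℝ) • x)‖ := by
  rw [fourierInv_packet_apply ρ ζ hμ, Circle.norm_smul]

lemma integral_packet (ρ : 𝓢(𝔼, ℂ)) (ζ : 𝔼) {μ : ℝˣ} (hμ : 0 < (μ : ℝ)) :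
    ∫ x, packet ρ ζ μ x = ∫ x, ρ x := by
  have := fourierInv_packet_apply ρ ζ hμ 0
  simpa [fourierInv_coe, Real.fourierInv_eq] using this

lemma IsCutoff.norm_fourierInv_dyadicSchwartz (hψ : IsCutoff ψ) (j : ℤ) (y : 𝔼) :
    ‖𝓕⁻ (hψ.dyadicSchwartz j) y‖ =
      ((2 : ℝ) ^ j) ^ n * ‖𝓕⁻ (hψ.dyadicSchwartz 0) (((2 : ℝ) ^ j) • y)‖ := by
  have h2 : (0 : ℝ) < 2 ^ j := by positivity
  have h : hψ.dyadicSchwartz j = dilate (Units.mk0 ((2 : ℝ) ^ j) h2.ne')⁻¹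
      (hψ.dyadicSchwartz 0) := by
    ext ξ
    rw [IsCutoff.dyadicSchwartz_apply, dyadic_eq_dyadic_zero]
    simp
  rw [h, fourierInv_dilate_apply, norm_smul]
  simp

/-- Frequency-localized pieces of wave packets decay at the scale of the packet. -/
lemma IsCutoff.exists_norm_block_packet_le (hψ : IsCutoff ψ) (ρ : 𝓢(𝔼, ℂ)) (L M : ℕ) :
    ∃ C : ℝ, 0 < C ∧ ∀ (j k : ℤ) (ζ : 𝔼) (μ : ℝˣ), k ≤ j + L → 0 < (μ : ℝ) → (μ : ℝ) ≤ 2 ^ k →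
      ∀ x, ‖𝓕⁻ (schwartzMul (hψ.dyadicSchwartz j) (packet ρ ζ μ)) x‖ ≤
        C * ((1 + ‖(μ : ℝ) • x‖) ^ M)⁻¹ := by
  obtain ⟨B, hB, hρ⟩ := exists_schwartz_norm_le (𝓕⁻ ρ) M
  set H : 𝔼 → ℝ := fun z => ‖𝓕⁻ (hψ.dyadicSchwartz 0) z‖ * (1 + ‖z‖) ^ M with hH
  have hHint : Integrable H := integrable_norm_mul_one_add_pow _ M
  have hH0 : 0 ≤ ∫ z, H z := integral_nonneg fun z => by positivity
  refine ⟨B * (2 ^ L) ^ M * ((∫ z, H z) + 1), by positivity, fun j k ζ μ hkj hμ hμk x => ?_⟩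
  have h2 : (0 : ℝ) < 2 ^ j := by positivity
  rw [fourierInv_schwartzMul_apply]
  have hμj : (μ : ℝ) ≤ 2 ^ L * 2 ^ j := by
    refine hμk.trans ?_
    rw [mul_comm, ← zpow_natCast, ← zpow_add₀ (by norm_num)]
    exact zpow_le_zpow_right₀ (by norm_num) hkj
  have hscale : ∫ y, ((2 : ℝ) ^ j) ^ n * H (((2 : ℝ) ^ j) • y) = ∫ z, H z := by
    rw [integral_const_mul, Measure.integral_comp_smul, abs_of_pos (by positivity),
      smul_eq_mul, finrank_euclideanSpace_fin, mul_inv_cancel_left₀ (by positivity)]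
  have hpt : ∀ y, ‖𝓕⁻ (hψ.dyadicSchwartz j) y * 𝓕⁻ (packet ρ ζ μ) (x - y)‖ ≤
      (B * (2 ^ L) ^ M * ((1 + ‖(μ : ℝ) • x‖) ^ M)⁻¹) *
        (((2 : ℝ) ^ j) ^ n * H (((2 : ℝ) ^ j) • y)) := fun y => by
    rw [norm_mul, hψ.norm_fourierInv_dyadicSchwartz, norm_fourierInv_packet_apply _ _ hμ]
    -- Peetre's inequality. Since `μ ≤ 2 ^ L * 2 ^ j`, the kernel of `Δ_j` is concentrated, up to
    -- the factor `2 ^ L`, at a scale no larger than the packet's, and its own weight absorbs the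
    -- translation by `y`.
    have htri : 1 + ‖(μ : ℝ) • x‖ ≤
        (1 + ‖(μ : ℝ) • (x - y)‖) * (2 ^ L * (1 + ‖((2 : ℝ) ^ j) • y‖)) := by
      have h1 : ‖(μ : ℝ) • x‖ ≤ ‖(μ : ℝ) • (x - y)‖ + ‖(μ : ℝ) • y‖ := by
        have := norm_add_le ((μ : ℝ) • (x - y)) ((μ : ℝ) • y)
        rwa [← smul_add, sub_add_cancel] at this
      have h3 : ‖(μ : ℝ) • y‖ ≤ 2 ^ L * ‖((2 : ℝ) ^ j) • y‖ := by
        rw [norm_smul, norm_smul, Real.norm_of_nonneg hμ.le, Real.norm_of_nonneg h2.le,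
          ← mul_assoc]
        gcongr
      have h4 : (1 : ℝ) ≤ 2 ^ L := one_le_pow₀ (by norm_num)
      have h5 : 1 + 2 ^ L * ‖((2 : ℝ) ^ j) • y‖ ≤ 2 ^ L * (1 + ‖((2 : ℝ) ^ j) • y‖) := by linarith
      calc 1 + ‖(μ : ℝ) • x‖ ≤ (1 + ‖(μ : ℝ) • (x - y)‖) * (1 + ‖(μ : ℝ) • y‖) := by
            nlinarith [norm_nonneg ((μ : ℝ) • (x - y)), norm_nonneg ((μ : ℝ) • y)]
        _ ≤ _ := by gcongr; linarith
    have hpow := pow_le_pow_left₀ (by positivity) htri M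
    rw [mul_pow, mul_pow] at hpow
    have hρ' := hρ ((μ : ℝ) • (x - y))
    set X := (1 + ‖(μ : ℝ) • x‖) ^ M
    set Y := (1 + ‖(μ : ℝ) • (x - y)‖) ^ M
    set Z := (1 + ‖((2 : ℝ) ^ j) • y‖) ^ M with hZ
    have hX : 0 < X := by positivity
    have hY : 0 < Y := by positivity
    have hinv : Y⁻¹ ≤ (2 ^ L) ^ M * Z * X⁻¹ := by
      rw [← div_eq_mul_inv, inv_le_iff_one_le_mul₀ hY, div_mul_eq_mul_div, le_div_iff₀ hX]
      linarith
    calc _ ≤ ((2 : ℝ) ^ j) ^ n * ‖𝓕⁻ (hψ.dyadicSchwartz 0) (((2 : ℝ) ^ j) • y)‖ *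
          (B * ((2 ^ L) ^ M * Z * X⁻¹)) := by
          gcongr
          exact hρ'.trans (by gcongr)
      _ = _ := by rw [hH]; simp only [← hZ]; ring
  refine (norm_integral_le_of_norm_le ?_ (Filter.Eventually.of_forall hpt)).trans ?_
  · exact ((hHint.comp_smul h2.ne').const_mul _).const_mul _
  · rw [integral_const_mul, hscale, mul_right_comm]
    gcongr
    linarith

/-- Frequency-localized pieces of wave packets do not vanish near their centre. -/
lemma IsCutoff.exists_le_norm_block_packet (hψ : IsCutoff ψ) {ρ : 𝓢(𝔼, ℂ)} {ξ₀ : 𝔼} {r m : ℝ}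
    (hr : 0 < r) (hm : 0 < m) (hφ : ∀ ξ, ‖ξ - ξ₀‖ < r → m ≤ dyadic ψ 0 ξ)
    (hρ : ∀ x, ∃ t : ℝ, 0 ≤ t ∧ ρ x = t) (hρ0 : ρ 0 ≠ 0) (hρr : ∀ x, r ≤ ‖x‖ → ρ x = 0) :
    ∃ c : ℝ, 0 < c ∧ ∀ (k : ℤ) (μ : ℝˣ), 0 < (μ : ℝ) → (μ : ℝ) ≤ 2 ^ k →
      ∀ x, ‖(μ : ℝ) • x‖ ≤ 1 / (8 * r) →
        c ≤ ‖𝓕⁻ (schwartzMul (hψ.dyadicSchwartz k) (packet ρ ((2 : ℝ) ^ k • ξ₀) μ)) x‖ := by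
  refine ⟨1 / 2 * m * (∫ x, ρ x).re, by have := integral_re_pos hρ hρ0; positivity,
    fun k μ hμ hμk x hx => ?_⟩
  set ζ := (2 : ℝ) ^ k • ξ₀ with hζ
  set f := schwartzMul (hψ.dyadicSchwartz k) (packet ρ ζ μ) with hf
  have h2 : (0 : ℝ) < 2 ^ k := by positivity
  -- Removing the carrier frequency `ζ` does not change the modulus and leaves only the slow phase
  -- `⟨v - ζ, x⟩`, so the real part of the integrand can be bounded below.
  have h1 : ‖𝓕⁻ f x‖ = ‖∫ v, Real.fourierChar (inner ℝ (v - ζ) x) • f v‖ := by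
    rw [← Circle.norm_smul (Real.fourierChar (-inner ℝ ζ x)), fourierInv_coe, Real.fourierInv_eq,
      Circle.smul_def, ← integral_smul]
    congr 2
    ext v
    rw [← Circle.smul_def, smul_smul, ← AddChar.map_add_eq_mul, inner_sub_left,
      neg_add_eq_sub]
  have hint : Integrable (fun v => Real.fourierChar (inner ℝ (v - ζ) x) • f v) := by
    refine f.integrable.norm.mono' ?_ (Filter.Eventually.of_forall fun v => ?_)
    · refine Continuous.aestronglyMeasurable ?_
      have := Real.continuous_fourierChar
      fun_prop
    · rw [Circle.norm_smul]
  rw [h1]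
  refine le_trans ?_ (Complex.re_le_norm _)
  have h3 : (∫ v, Real.fourierChar (inner ℝ (v - ζ) x) • f v).re =
      ∫ v, (Real.fourierChar (inner ℝ (v - ζ) x) • f v).re := by
    simpa using (Complex.reCLM.integral_comp_comm hint).symm
  have h4 : (∫ x, ρ x).re = ∫ v, (packet ρ ζ μ v).re := by
    rw [← integral_packet ρ ζ hμ]
    simpa using (Complex.reCLM.integral_comp_comm (packet ρ ζ μ).integrable).symm
  rw [h3, h4, ← integral_const_mul]
  refine integral_mono ((packet ρ ζ μ).integrable.re.const_mul _) hint.re fun v => ?_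
  obtain ⟨t, ht, hv⟩ := hρ ((μ : ℝ)⁻¹ • (v - ζ))
  have hpk : packet ρ ζ μ v = ((((μ : ℝ) ^ n)⁻¹ * t : ℝ) : ℂ) := by
    rw [packet_apply, hv]; push_cast; rfl
  have hpk0 : 0 ≤ ((μ : ℝ) ^ n)⁻¹ * t := by positivity
  set w := ((μ : ℝ) ^ n)⁻¹ * t with hw
  have hfv : f v = ((dyadic ψ k v * w : ℝ) : ℂ) := by
    rw [hf, schwartzMul_apply, hpk]; simp
  change 1 / 2 * m * (packet ρ ζ μ v).re ≤ (Real.fourierChar (inner ℝ (v - ζ) x) • f v).re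
  rw [hpk, hfv, Circle.smul_def, Real.fourierChar_apply, smul_eq_mul, Complex.re_mul_ofReal,
    Complex.ofReal_re, Complex.exp_ofReal_mul_I_re]
  by_cases hvr : r ≤ ‖(μ : ℝ)⁻¹ • (v - ζ)‖
  · have : t = 0 := by
      have := hρr _ hvr
      rw [hv] at this; exact_mod_cast this
    simp [hw, this]
  rw [not_le, norm_smul, norm_inv, Real.norm_of_nonneg hμ.le, inv_mul_lt_iff₀ hμ] at hvr
  have hdy : m ≤ dyadic ψ k v := by
    rw [dyadic_eq_dyadic_zero]
    apply hφ
    have : (2 : ℝ) ^ (-k) • v - ξ₀ = (2 : ℝ) ^ (-k) • (v - ζ) := by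
      rw [hζ, smul_sub, smul_smul, ← zpow_add₀ (by norm_num)]; simp
    rw [this, norm_smul, norm_zpow, zpow_neg, Real.norm_ofNat, inv_mul_lt_iff₀ h2]
    exact hvr.trans_le (by gcongr)
  have hin : |inner ℝ (v - ζ) x| ≤ 1 / 8 := by
    refine (abs_real_inner_le_norm _ _).trans ?_
    rw [norm_smul, Real.norm_of_nonneg hμ.le] at hx
    calc ‖v - ζ‖ * ‖x‖ ≤ (μ * r) * ‖x‖ := by gcongr
      _ = r * (μ * ‖x‖) := by ring
      _ ≤ r * (1 / (8 * r)) := by gcongr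
      _ = 1 / 8 := by field_simp
  -- The phase is at most `2π / 8 ≤ 1` by the crude bound `π ≤ 4`, and `cos t ≥ 1 - t ^ 2 / 2`.
  have hcos : 1 / 2 ≤ Real.cos (2 * Real.pi * inner ℝ (v - ζ) x) := by
    refine le_trans ?_ (Real.one_sub_sq_div_two_le_cos)
    set y := inner ℝ (v - ζ) x
    have hy : y ^ 2 ≤ (1 / 8) ^ 2 := sq_le_sq' (by linarith [(abs_le.1 hin).1]) (abs_le.1 hin).2
    have hpi : Real.pi ^ 2 ≤ 16 := by nlinarith [Real.pi_pos, Real.pi_le_four]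
    have : (2 * Real.pi * y) ^ 2 = 4 * (Real.pi ^ 2 * y ^ 2) := by ring
    have h5 : Real.pi ^ 2 * y ^ 2 ≤ 16 * (1 / 8) ^ 2 := by gcongr
    rw [this]; linarith
  calc 1 / 2 * m * w = 1 / 2 * (m * w) := by ring
    _ ≤ Real.cos (2 * Real.pi * inner ℝ (v - ζ) x) * (dyadic ψ k v * w) := by gcongr

/-- A wave packet meets only finitely many dyadic annuli, uniformly in its frequency. -/
lemma IsCutoff.exists_schwartzMul_packet_eq_zero (hψ : IsCutoff ψ) {ξ₀ : 𝔼}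
    (hξ₀ : dyadic ψ 0 ξ₀ ≠ 0) :
    ∃ L : ℕ, ∀ (ρ : 𝓢(𝔼, ℂ)) (j k : ℤ) (μ : ℝˣ), (∀ x, ‖ξ₀‖ / 2 ≤ ‖x‖ → ρ x = 0) →
      0 < (μ : ℝ) → (μ : ℝ) ≤ 2 ^ k → (L : ℤ) < |j - k| →
        schwartzMul (hψ.dyadicSchwartz j) (packet ρ ((2 : ℝ) ^ k • ξ₀) μ) = 0 := by
  obtain ⟨c, hc, hφ⟩ := hψ.exists_dyadic_zero_eq_zero
  have hc1 : c ≤ ‖ξ₀‖ := by by_contra! h; exact hξ₀ (hφ _ h)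
  have hc2 : ‖ξ₀‖ ≤ 2 := by by_contra! h; exact hξ₀ (hψ.dyadic_zero_eq_zero h)
  -- On the packet `|ξ|` lies between `2^k |ξ₀| / 2` and `3 · 2^k |ξ₀| / 2`, and on the annulus
  -- between `c 2^j` and `2 · 2^j`. As `c ≤ |ξ₀| ≤ 2`, an overlap with `j - k > L` would give `2^L c
  -- < 3`, and one with `k - j > L` would give `2^L c < 4`.
  obtain ⟨L, hL⟩ := pow_unbounded_of_one_lt (4 / c) (one_lt_two (α := ℝ))
  rw [div_lt_iff₀ hc] at hL
  refine ⟨L, fun ρ j k μ hρ hμ hμk hjk => ?_⟩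
  ext ξ
  rw [schwartzMul_apply, packet_apply, IsCutoff.dyadicSchwartz_apply, zero_apply]
  by_contra hne
  have h1 : dyadic ψ j ξ ≠ 0 := by
    intro h; simp [h] at hne
  have h2 : ρ ((μ : ℝ)⁻¹ • (ξ - (2 : ℝ) ^ k • ξ₀)) ≠ 0 := by
    intro h; simp [h] at hne
  have h3 : ‖ξ - (2 : ℝ) ^ k • ξ₀‖ < 2 ^ k * (‖ξ₀‖ / 2) := by
    by_contra! h
    refine h2 (hρ _ ?_)
    rw [norm_smul, norm_inv, Real.norm_of_nonneg hμ.le, inv_mul_eq_div, le_div_iff₀ hμ]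
    refine le_trans ?_ h
    rw [mul_comm]; gcongr
  have hj : (0 : ℝ) < 2 ^ j := by positivity
  have hk : (0 : ℝ) < 2 ^ k := by positivity
  rw [dyadic_eq_dyadic_zero] at h1
  have hnorm : ‖((2 : ℝ) ^ (-j)) • ξ‖ = ‖ξ‖ / 2 ^ j := by
    rw [norm_smul, norm_zpow, zpow_neg, Real.norm_ofNat, inv_mul_eq_div]
  have h4 : c * 2 ^ j ≤ ‖ξ‖ := by
    by_contra! h
    exact h1 (hφ _ (by rw [hnorm, div_lt_iff₀ hj]; exact h))
  have h5 : ‖ξ‖ ≤ 2 * 2 ^ j := by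
    by_contra! h
    exact h1 (hψ.dyadic_zero_eq_zero (by rw [hnorm, lt_div_iff₀ hj]; exact h))
  have h6 : ‖(2 : ℝ) ^ k • ξ₀‖ = 2 ^ k * ‖ξ₀‖ := by rw [norm_smul, Real.norm_of_nonneg hk.le]
  have h7 : ‖ξ‖ ≤ ‖ξ - (2 : ℝ) ^ k • ξ₀‖ + 2 ^ k * ‖ξ₀‖ := by
    rw [← h6]; simpa using norm_add_le (ξ - (2 : ℝ) ^ k • ξ₀) ((2 : ℝ) ^ k • ξ₀)
  have h8 : 2 ^ k * ‖ξ₀‖ ≤ ‖ξ - (2 : ℝ) ^ k • ξ₀‖ + ‖ξ‖ := by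
    rw [← h6, norm_sub_rev]; simpa using norm_add_le ((2 : ℝ) ^ k • ξ₀ - ξ) ξ
  have h9 : (2 : ℝ) ^ k * c ≤ 2 ^ k * ‖ξ₀‖ := by gcongr
  have h10 : (2 : ℝ) ^ k * ‖ξ₀‖ ≤ 2 ^ k * 2 := by gcongr
  rcases lt_abs.1 hjk with h | h
  · have : (2 : ℝ) ^ L * 2 ^ k ≤ 2 ^ j := by
      rw [← zpow_natCast, ← zpow_add₀ (by norm_num)]
      exact zpow_le_zpow_right₀ (by norm_num) (by linarith)
    have : 4 * (2 : ℝ) ^ k < 2 ^ L * c * 2 ^ k := by gcongr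
    nlinarith
  · have : (2 : ℝ) ^ L * 2 ^ j ≤ 2 ^ k := by
      rw [← zpow_natCast, ← zpow_add₀ (by norm_num)]
      exact zpow_le_zpow_right₀ (by norm_num) (by linarith)
    have : 4 * (2 : ℝ) ^ j < 2 ^ L * c * 2 ^ j := by gcongr
    nlinarith

end Wavelet

/-! ### Superpositions of packets and their Besov norms. -/

section TestFunctions

open FourierTransform SchwartzMap

variable {n : ℕ} {ψ : EuclideanSpace ℝ (Fin n) → ℝ}

lemma two_rpow_pos (x : ℝ) : 0 < (2 : ℝ) ^ x := by positivity

/-- The real power `2 ^ x` as a unit. -/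
noncomputable def twoRpowUnit (x : ℝ) : ℝˣ := Units.mk0 ((2 : ℝ) ^ x) (two_rpow_pos x).ne'

@[simp] lemma coe_twoRpowUnit (x : ℝ) : (twoRpowUnit x : ℝ) = 2 ^ x := rfl

lemma ofReal_two_rpow (x : ℝ) : ENNReal.ofReal ((2 : ℝ) ^ x) = 2 ^ x := by
  rw [← ENNReal.ofReal_rpow_of_pos (by norm_num)]; simp

/-- The Fourier transform of the superposition, over the frequencies `2 ^ k`, `k ∈ S`, of wave
packets of amplitude `2 ^ α k` and width `2 ^ (-β k)`. -/
noncomputable def superposition (ρ : 𝓢(EuclideanSpace ℝ (Fin n), ℂ)) (ξ₀ : EuclideanSpace ℝ (Fin n))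
    (S : Finset ℤ) (α β : ℤ → ℝ) : 𝓢(EuclideanSpace ℝ (Fin n), ℂ) :=
  ∑ k ∈ S, (((2 : ℝ) ^ α k : ℝ) : ℂ) • packet ρ ((2 : ℝ) ^ k • ξ₀) (twoRpowUnit (β k))

lemma IsCutoff.distLpNorm_block_superposition (hψ : IsCutoff ψ)
    (ρ : 𝓢(EuclideanSpace ℝ (Fin n), ℂ)) (ξ₀ : EuclideanSpace ℝ (Fin n))
    (S : Finset ℤ) (α β : ℤ → ℝ) (j : ℤ) (p : ℝ≥0∞) :
    distLpNorm p (block ψ j ((𝓕⁻ (superposition ρ ξ₀ S α β) :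
      𝓢(EuclideanSpace ℝ (Fin n), ℂ)) : 𝓢'(EuclideanSpace ℝ (Fin n), ℂ))) =
      eLpNorm (𝓕⁻ (schwartzMul (hψ.dyadicSchwartz j) (superposition ρ ξ₀ S α β)) :
        𝓢(EuclideanSpace ℝ (Fin n), ℂ)) p volume := by
  rw [block_coe hψ, (isRepresentedBy_coe _).distLpNorm_eq]

/-- When at most one packet of the superposition meets the annulus `j`, the block reduces to that
packet; this makes norms of sums computable for quasi-norms too. -/
lemma schwartzMul_superposition (hψ : IsCutoff ψ)
    {ρ : 𝓢(EuclideanSpace ℝ (Fin n), ℂ)} {ξ₀ : EuclideanSpace ℝ (Fin n)} {S : Finset ℤ}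
    {α β : ℤ → ℝ} {j k : ℤ} (hk : k ∈ S)
    (h : ∀ l ∈ S, l ≠ k → schwartzMul (hψ.dyadicSchwartz j)
      (packet ρ ((2 : ℝ) ^ l • ξ₀) (twoRpowUnit (β l))) = 0) :
    schwartzMul (hψ.dyadicSchwartz j) (superposition ρ ξ₀ S α β) =
      (((2 : ℝ) ^ α k : ℝ) : ℂ) • schwartzMul (hψ.dyadicSchwartz j)
        (packet ρ ((2 : ℝ) ^ k • ξ₀) (twoRpowUnit (β k))) := by
  rw [superposition, schwartzMul, map_sum, Finset.sum_eq_single k]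
  · rw [map_smul]; rfl
  · intro l hl hlk
    rw [map_smul]
    change _ • schwartzMul _ _ = _
    rw [h l hl hlk, smul_zero]
  · exact fun h => absurd hk h

lemma schwartzMul_superposition_eq_zero (hψ : IsCutoff ψ)
    {ρ : 𝓢(EuclideanSpace ℝ (Fin n), ℂ)} {ξ₀ : EuclideanSpace ℝ (Fin n)} {S : Finset ℤ}
    {α β : ℤ → ℝ} {j : ℤ} (h : ∀ l ∈ S, schwartzMul (hψ.dyadicSchwartz j)
      (packet ρ ((2 : ℝ) ^ l • ξ₀) (twoRpowUnit (β l))) = 0) :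
    schwartzMul (hψ.dyadicSchwartz j) (superposition ρ ξ₀ S α β) = 0 := by
  rw [superposition, schwartzMul, map_sum]
  refine Finset.sum_eq_zero fun l hl => ?_
  rw [map_smul]
  change _ • schwartzMul _ _ = _
  rw [h l hl, smul_zero]

lemma eLpNorm_fourierInv_smul (a : ℝ) (f : 𝓢(EuclideanSpace ℝ (Fin n), ℂ)) (p : ℝ≥0∞) :
    eLpNorm (𝓕⁻ ((((2 : ℝ) ^ a : ℝ) : ℂ) • f) : 𝓢(EuclideanSpace ℝ (Fin n), ℂ)) p volume =
      2 ^ a * eLpNorm (𝓕⁻ f : 𝓢(EuclideanSpace ℝ (Fin n), ℂ)) p volume := by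
  rw [FourierTransform.fourierInv_smul]
  change eLpNorm ((((2 : ℝ) ^ a : ℝ) : ℂ) • ((𝓕⁻ f : 𝓢(EuclideanSpace ℝ (Fin n), ℂ)) :
    EuclideanSpace ℝ (Fin n) → ℂ)) p volume = _
  rw [eLpNorm_const_smul, ← ofReal_norm, Complex.norm_real, Real.norm_of_nonneg (by positivity),
    ofReal_two_rpow]

/-- Upper bound for the `L^p` norm of a frequency-localized wave packet. -/
lemma IsCutoff.exists_eLpNorm_block_packet_le (hψ : IsCutoff ψ)
    (ρ : 𝓢(EuclideanSpace ℝ (Fin n), ℂ)) (L : ℕ) {p : ℝ≥0∞} (hp : 0 < p) :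
    ∃ C : ℝ≥0, ∀ (j k : ℤ) (ζ : EuclideanSpace ℝ (Fin n)) (b : ℝ), k ≤ j + L → b ≤ k →
      eLpNorm (𝓕⁻ (schwartzMul (hψ.dyadicSchwartz j) (packet ρ ζ (twoRpowUnit b))) :
        𝓢(EuclideanSpace ℝ (Fin n), ℂ)) p volume ≤ C * 2 ^ (-(b * (n * recip p))) := by
  obtain ⟨M, hM⟩ := exists_eLpNorm_inv_one_add_pow_lt_top (E := EuclideanSpace ℝ (Fin n)) hp
  obtain ⟨C, hC, h⟩ := hψ.exists_norm_block_packet_le ρ L M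
  have hfin : ENNReal.ofReal C *
      eLpNorm (fun x : EuclideanSpace ℝ (Fin n) => ((1 + ‖x‖) ^ M)⁻¹) p volume ≠ ⊤ :=
    ENNReal.mul_ne_top ENNReal.ofReal_ne_top hM.ne
  refine ⟨(ENNReal.ofReal C * eLpNorm (fun x : EuclideanSpace ℝ (Fin n) =>
    ((1 + ‖x‖) ^ M)⁻¹) p volume).toNNReal, fun j k ζ b hkj hb => ?_⟩
  rw [ENNReal.coe_toNNReal hfin]
  have hb' : (2 : ℝ) ^ b ≤ 2 ^ k := by
    rw [← Real.rpow_intCast]; exact Real.rpow_le_rpow_of_exponent_le (by norm_num) hb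
  have hsm : StronglyMeasurable (fun x : EuclideanSpace ℝ (Fin n) => ((1 + ‖x‖) ^ M)⁻¹) := by
    refine Continuous.stronglyMeasurable (Continuous.inv₀ (by fun_prop) fun x => ?_)
    positivity
  calc _ ≤ eLpNorm (fun x : EuclideanSpace ℝ (Fin n) =>
        C • ((1 + ‖((2 : ℝ) ^ b) • x‖) ^ M)⁻¹) p volume :=
        eLpNorm_mono_real fun x => by
          simpa using h j k ζ (twoRpowUnit b) hkj (two_rpow_pos b) hb' x
    _ = _ := by
        change eLpNorm (C • fun x : EuclideanSpace ℝ (Fin n) =>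
          ((1 + ‖((2 : ℝ) ^ b) • x‖) ^ M)⁻¹) p volume = _
        rw [eLpNorm_const_smul, eLpNorm_comp_smul hsm p (two_rpow_pos b), ofReal_two_rpow,
          ← ENNReal.rpow_mul, finrank_euclideanSpace_fin, ← ofReal_norm,
          Real.norm_of_nonneg hC.le, mul_neg]
        ring

/-- Lower bound for the `L^p` norm of a frequency-localized wave packet. -/
lemma IsCutoff.exists_le_eLpNorm_block_packet (hψ : IsCutoff ψ)
    {ρ : 𝓢(EuclideanSpace ℝ (Fin n), ℂ)} {ξ₀ : EuclideanSpace ℝ (Fin n)} {r m : ℝ}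
    (hr : 0 < r) (hm : 0 < m) (hφ : ∀ ξ, ‖ξ - ξ₀‖ < r → m ≤ dyadic ψ 0 ξ)
    (hρ : ∀ x, ∃ t : ℝ, 0 ≤ t ∧ ρ x = t) (hρ0 : ρ 0 ≠ 0) (hρr : ∀ x, r ≤ ‖x‖ → ρ x = 0)
    {p : ℝ≥0∞} (hp : 0 < p) :
    ∃ c : ℝ≥0, 0 < c ∧ ∀ (k : ℤ) (b : ℝ), b ≤ k →
      c * (2 : ℝ≥0∞) ^ (-(b * (n * recip p))) ≤
        eLpNorm (𝓕⁻ (schwartzMul (hψ.dyadicSchwartz k)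
          (packet ρ ((2 : ℝ) ^ k • ξ₀) (twoRpowUnit b))) :
            𝓢(EuclideanSpace ℝ (Fin n), ℂ)) p volume := by
  obtain ⟨c, hc, h⟩ := hψ.exists_le_norm_block_packet hr hm hφ hρ hρ0 hρr
  set B : Set (EuclideanSpace ℝ (Fin n)) := Metric.closedBall 0 (1 / (8 * r)) with hB
  set I : EuclideanSpace ℝ (Fin n) → ℝ := B.indicator fun _ => c with hI
  have hsm : StronglyMeasurable I :=
    stronglyMeasurable_const.indicator Metric.isClosed_closedBall.measurableSet
  have hI0 : eLpNorm I p volume ≠ 0 := by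
    intro h0
    have := (eLpNorm_eq_zero_iff hsm.aestronglyMeasurable hp.ne').1 h0
    have hpos : 0 < volume B := Metric.measure_closedBall_pos volume _ (by positivity)
    refine hpos.ne' (measure_mono_null (fun x hx => ?_) this)
    simp only [Set.mem_compl_iff, Set.mem_ofPred_eq, hI, Set.indicator_of_mem hx]
    exact hc.ne'
  obtain ⟨d, hd0, hd⟩ : ∃ d : ℝ≥0, 0 < d ∧ (d : ℝ≥0∞) ≤ eLpNorm I p volume := by
    obtain ⟨d, hd0, hd⟩ := ENNReal.lt_iff_exists_nnreal_btwn.1 (pos_iff_ne_zero.2 hI0)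
    exact ⟨d, by exact_mod_cast hd0, hd.le⟩
  refine ⟨d, hd0, fun k b hb => ?_⟩
  have hb' : (2 : ℝ) ^ b ≤ 2 ^ k := by
    rw [← Real.rpow_intCast]; exact Real.rpow_le_rpow_of_exponent_le (by norm_num) hb
  calc (d : ℝ≥0∞) * 2 ^ (-(b * (n * recip p)))
      ≤ eLpNorm I p volume * 2 ^ (-(b * (n * recip p))) := by gcongr
    _ = eLpNorm (fun x => I (((2 : ℝ) ^ b) • x)) p volume := by
        rw [eLpNorm_comp_smul hsm p (two_rpow_pos b), ofReal_two_rpow, ← ENNReal.rpow_mul,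
          finrank_euclideanSpace_fin, mul_neg, mul_comm]
    _ ≤ _ := by
        refine eLpNorm_mono fun x => ?_
        by_cases hx : ((2 : ℝ) ^ b) • x ∈ B
        · rw [hI, Set.indicator_of_mem hx, Real.norm_of_nonneg hc.le]
          exact h k (twoRpowUnit b) (two_rpow_pos b) hb' x (by simpa [hB] using hx)
        · rw [hI, Set.indicator_of_notMem hx]; simp

/-- A family of test functions with prescribed sizes of the blocks. -/
theorem exists_testFunctions (hn : 1 ≤ n) (hψ : IsCutoff ψ) :
    ∃ (L : ℕ) (U : Finset ℤ → (ℤ → ℝ) → (ℤ → ℝ) → 𝓢'(EuclideanSpace ℝ (Fin n), ℂ)),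
      (∀ (s : ℝ) (p q : ℝ≥0∞), 0 < p → 0 < q → ∃ C : ℝ≥0, ∀ (S : Finset ℤ) (α β : ℤ → ℝ) (e : ℝ),
        (∀ k ∈ S, ∀ l ∈ S, k ≠ l → (L : ℤ) < |k - l|) → (∀ k ∈ S, β k ≤ k) →
        (∀ k ∈ S, k * s + α k - β k * (n * recip p) ≤ e) →
        besovNorm ψ s p q (U S α β) ≤ C * 2 ^ e * (S.card : ℝ≥0∞) ^ recip q) ∧
      (∀ (s : ℝ) (p q : ℝ≥0∞), 0 < p → 0 < q → ∃ c : ℝ≥0, 0 < c ∧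
        ∀ (S : Finset ℤ) (α β : ℤ → ℝ) (e : ℝ), S.Nonempty →
        (∀ k ∈ S, ∀ l ∈ S, k ≠ l → (L : ℤ) < |k - l|) → (∀ k ∈ S, β k ≤ k) →
        (∀ k ∈ S, e ≤ k * s + α k - β k * (n * recip p)) →
        c * 2 ^ e * (S.card : ℝ≥0∞) ^ recip q ≤ besovNorm ψ s p q (U S α β)) := by
  obtain ⟨ξ₀, hξ₀⟩ := hψ.exists_dyadic_zero_pos hn
  obtain ⟨L, hL⟩ := hψ.exists_schwartzMul_packet_eq_zero hξ₀.ne'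
  have hξ₀' : ξ₀ ≠ 0 := by
    rintro rfl
    obtain ⟨c, hc, h⟩ := hψ.exists_dyadic_zero_eq_zero
    rw [h 0 (by simpa using hc)] at hξ₀
    exact lt_irrefl _ hξ₀
  obtain ⟨r', hr', hφ'⟩ := Metric.eventually_nhds_iff.1
    ((hψ.contDiff_dyadic 0).continuous.continuousAt.eventually (lt_mem_nhds (half_lt_self hξ₀)))
  -- Radius `r'` keeps `φ` above half of `φ(ξ₀)` for the lower bound; radius `‖ξ₀‖ / 2` keeps the
  -- packets away from the origin.
  set r := min r' (‖ξ₀‖ / 2) with hr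
  have hrpos : 0 < r := lt_min hr' (by have := norm_pos_iff.2 hξ₀'; positivity)
  have hφ : ∀ ξ, ‖ξ - ξ₀‖ < r → dyadic ψ 0 ξ₀ / 2 ≤ dyadic ψ 0 ξ := fun ξ hξ =>
    (hφ' (by rw [dist_eq_norm]; exact hξ.trans_le (min_le_left _ _))).le
  obtain ⟨ρ, hρ1, hρ2, hρ⟩ :=
    exists_schwartz_cutoff (E := EuclideanSpace ℝ (Fin n)) (r / 2) (by positivity)
  rw [mul_div_cancel₀ _ (two_ne_zero)] at hρ2
  have hρ0 : ρ 0 ≠ 0 := by rw [hρ1 0 (by simp; positivity)]; exact one_ne_zero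
  have hvanish : ∀ (j k : ℤ) (b : ℝ), b ≤ k → (L : ℤ) < |j - k| →
      schwartzMul (hψ.dyadicSchwartz j) (packet ρ ((2 : ℝ) ^ k • ξ₀) (twoRpowUnit b)) = 0 := by
    intro j k b hb hjk
    refine hL ρ j k _ (fun x hx => hρ2 x ((min_le_right _ _).trans hx)) (two_rpow_pos b) ?_ hjk
    rw [coe_twoRpowUnit, ← Real.rpow_intCast]
    exact Real.rpow_le_rpow_of_exponent_le (by norm_num) hb
  -- A packet reaches at most `L` annuli on each side, so a separation beyond `2 L` lets no annulus
  -- meet two packets.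
  refine ⟨2 * L, fun S α β => ((𝓕⁻ (superposition ρ ξ₀ S α β) :
      𝓢(EuclideanSpace ℝ (Fin n), ℂ)) : 𝓢'(EuclideanSpace ℝ (Fin n), ℂ)), ?_, ?_⟩
  · intro s p q hp hq
    obtain ⟨C, hC⟩ := hψ.exists_eLpNorm_block_packet_le ρ L hp
    -- The first factor pays for replacing the weight at `j` by the weight at `k`, `|j - k| ≤ L`;
    -- the last one for the at most `2 L + 1` blocks met by each packet.
    refine ⟨(2 : ℝ≥0) ^ (L * |s|) * C * ((2 * L + 1 : ℕ) : ℝ≥0) ^ recip q,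
      fun S α β e hS hβ he => ?_⟩
    set S' : Finset ℤ := S.biUnion fun k => Finset.Icc (k - L) (k + L) with hS'
    have hcard : S'.card ≤ S.card * (2 * L + 1) := by
      refine Finset.card_biUnion_le_card_mul _ _ _ fun k _ => ?_
      rw [Int.card_Icc]; omega
    have hmem : ∀ j, j ∈ S' ↔ ∃ k ∈ S, |j - k| ≤ L := fun j => by
      simp only [hS', Finset.mem_biUnion, Finset.mem_Icc]
      refine exists_congr fun k => and_congr_right fun _ => ?_
      rw [abs_le]; constructor <;> rintro ⟨h1, h2⟩ <;> constructor <;> linarith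
    refine (seqNorm_le_of_support hq S' (A := 2 ^ (L * |s|) * C * 2 ^ e) ?_ ?_).trans ?_
    · intro j hj
      obtain ⟨k, hk, hjk⟩ := (hmem j).1 hj
      rw [hψ.distLpNorm_block_superposition, schwartzMul_superposition hψ hk,
        eLpNorm_fourierInv_smul]
      · have hjk' := abs_le.1 hjk
        calc _ ≤ (2 : ℝ≥0∞) ^ ((j : ℝ) * s) * (2 ^ α k * (C * 2 ^ (-(β k * (n * recip p))))) := by
              gcongr
              exact hC j k _ _ (by linarith) (hβ k hk)
          _ = C * 2 ^ ((j : ℝ) * s + α k + -(β k * (n * recip p))) := by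
              rw [two_rpow_add, two_rpow_add]; ring
          _ ≤ C * 2 ^ (L * |s| + e) := by
              refine mul_le_mul_right (two_rpow_le ?_) _
              have h1 := he k hk
              have h2 : ((j : ℝ) - k) * s ≤ L * |s| := by
                refine (le_abs_self _).trans ?_
                rw [abs_mul]
                gcongr
                exact_mod_cast hjk
              linarith
          _ = _ := by rw [two_rpow_add]; ring
      · intro l hl hlk
        refine hvanish j l _ (hβ l hl) ?_
        have h1 := hS k hk l hl hlk.symm
        have h2 := abs_sub_le k j l
        rw [abs_sub_comm k j] at h2
        push_cast at h1
        linarith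
    · intro j hj
      have h0 : schwartzMul (hψ.dyadicSchwartz j) (superposition ρ ξ₀ S α β) = 0 := by
        refine schwartzMul_superposition_eq_zero hψ fun l hl => hvanish j l _ (hβ l hl) ?_
        by_contra! h
        exact hj ((hmem j).2 ⟨l, hl, h⟩)
      rw [hψ.distLpNorm_block_superposition, h0]
      have h1 : (𝓕⁻ (0 : 𝓢(EuclideanSpace ℝ (Fin n), ℂ))) = 0 :=
        map_zero (fourierInvCLM ℂ 𝓢(EuclideanSpace ℝ (Fin n), ℂ))
      rw [h1]
      have h2 : eLpNorm ((0 : 𝓢(EuclideanSpace ℝ (Fin n), ℂ)) : EuclideanSpace ℝ (Fin n) → ℂ) p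
        volume = 0 := eLpNorm_zero
      rw [h2, mul_zero]
    · have hcard' : (S'.card : ℝ≥0∞) ^ recip q ≤
          ((2 * L + 1 : ℕ) : ℝ≥0∞) ^ recip q * (S.card : ℝ≥0∞) ^ recip q := by
        rw [← ENNReal.mul_rpow_of_nonneg _ _ (recip_nonneg q)]
        refine ENNReal.rpow_le_rpow ?_ (recip_nonneg q)
        rw [mul_comm]; exact_mod_cast hcard
      calc _ ≤ 2 ^ (L * |s|) * C * 2 ^ e *
            (((2 * L + 1 : ℕ) : ℝ≥0∞) ^ recip q * (S.card : ℝ≥0∞) ^ recip q) := by gcongr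
        _ = _ := by
            rw [ENNReal.coe_mul, ENNReal.coe_mul, ENNReal.coe_rpow_of_nonneg _ (recip_nonneg q),
              ENNReal.coe_rpow_of_ne_zero (by norm_num), ENNReal.coe_natCast, ENNReal.coe_ofNat]
            ring
  · intro s p q hp hq
    obtain ⟨c, hc, h⟩ := hψ.exists_le_eLpNorm_block_packet hrpos (half_pos hξ₀) hφ hρ hρ0 hρ2 hp
    refine ⟨c, hc, fun S α β e hne hS hβ he => ?_⟩
    refine le_seqNorm_of_le hq S hne fun k hk => ?_
    rw [hψ.distLpNorm_block_superposition, schwartzMul_superposition hψ hk,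
      eLpNorm_fourierInv_smul]
    · calc (c : ℝ≥0∞) * 2 ^ e ≤ c * 2 ^ ((k : ℝ) * s + α k + -(β k * (n * recip p))) := by
            refine mul_le_mul_right (two_rpow_le ?_) _
            linarith [he k hk]
        _ = (2 : ℝ≥0∞) ^ ((k : ℝ) * s) * (2 ^ α k * (c * 2 ^ (-(β k * (n * recip p))))) := by
            rw [two_rpow_add, two_rpow_add]; ring
        _ ≤ _ := by
            gcongr
            exact h k (β k) (hβ k hk)
    · intro l hl hlk
      refine hvanish k l _ (hβ l hl) ?_
      have h1 := hS k hk l hl hlk.symm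
      push_cast at h1
      have : (0 : ℤ) ≤ L := by positivity
      linarith

end TestFunctions

/-! ### The inequality implies the conditions. -/

section Necessity

variable {n : ℕ} {ψ : EuclideanSpace ℝ (Fin n) → ℝ} {p p₀ p₁ q q₀ q₁ : ℝ≥0∞} {s s₀ s₁ θ : ℝ}

lemma le_of_two_rpow_le {x y : ℝ} (h : (2 : ℝ≥0∞) ^ x ≤ 2 ^ y) : x ≤ y := by
  by_contra! h'
  exact absurd (ENNReal.rpow_lt_rpow_of_exponent_lt (by norm_num) (by simp) h') (not_lt.2 h)

lemma exists_le_two_rpow (C : ℝ≥0) : ∃ t : ℝ, (C : ℝ≥0∞) ≤ 2 ^ t := by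
  obtain ⟨t, ht⟩ := exists_eq_two_rpow (x := (C : ℝ≥0∞) + 1) (by simp) (by simp)
  exact ⟨t, ht ▸ le_self_add⟩

/-- The multiplicative inequality in the space of exponents, tested on superpositions of wave
packets. -/
lemma exists_exponent_le (hn : 1 ≤ n) (hψ : IsCutoff ψ) (hp : 0 < p) (hp₀ : 0 < p₀) (hp₁ : 0 < p₁)
    (hq : 0 < q) (hq₀ : 0 < q₀) (hq₁ : 0 < q₁) (hθ₀ : 0 ≤ θ) (hθ₁ : θ ≤ 1)
    (h : ∃ C : ℝ≥0, ∀ u ∈ besovSpace ψ s₀ p₀ q₀ ∩ besovSpace ψ s₁ p₁ q₁,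
      besovNorm ψ s p q u ≤
        C * besovNorm ψ s₀ p₀ q₀ u ^ (1 - θ) * besovNorm ψ s₁ p₁ q₁ u ^ θ) :
    ∃ (L : ℕ) (K : ℝ), ∀ (S : Finset ℤ) (α β : ℤ → ℝ) (e e₀ e₁ : ℝ), S.Nonempty →
      (∀ k ∈ S, ∀ l ∈ S, k ≠ l → (L : ℤ) < |k - l|) → (∀ k ∈ S, β k ≤ k) →
      (∀ k ∈ S, k * s₀ + α k - β k * (n * recip p₀) ≤ e₀) →
      (∀ k ∈ S, k * s₁ + α k - β k * (n * recip p₁) ≤ e₁) →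
      (∀ k ∈ S, e ≤ k * s + α k - β k * (n * recip p)) →
      e + Real.logb 2 S.card * recip q ≤
        K + (1 - θ) * (e₀ + Real.logb 2 S.card * recip q₀) +
          θ * (e₁ + Real.logb 2 S.card * recip q₁) := by
  obtain ⟨C, hC⟩ := h
  obtain ⟨L, U, hup, hlow⟩ := exists_testFunctions hn hψ
  obtain ⟨C₀, h₀⟩ := hup s₀ p₀ q₀ hp₀ hq₀
  obtain ⟨C₁, h₁⟩ := hup s₁ p₁ q₁ hp₁ hq₁
  obtain ⟨c, hc, h⟩ := hlow s p q hp hq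
  obtain ⟨t, ht⟩ := exists_le_two_rpow C
  obtain ⟨t₀, ht₀⟩ := exists_le_two_rpow C₀
  obtain ⟨t₁, ht₁⟩ := exists_le_two_rpow C₁
  obtain ⟨b, hb⟩ := exists_eq_two_rpow (x := c) (by exact_mod_cast hc.ne') (by simp)
  refine ⟨L, t + (1 - θ) * t₀ + θ * t₁ - b, fun S α β e e₀ e₁ hne hS hβ he₀ he₁ he => ?_⟩
  have hcard : (S.card : ℝ≥0∞) = 2 ^ Real.logb 2 S.card := by
    rw [← ofReal_two_rpow, Real.rpow_logb (by norm_num) (by norm_num)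
      (by exact_mod_cast hne.card_pos)]
    simp
  set ν := Real.logb 2 S.card
  have hu₀ : besovNorm ψ s₀ p₀ q₀ (U S α β) ≤ 2 ^ (t₀ + (e₀ + ν * recip q₀)) := by
    refine (h₀ S α β e₀ hS hβ he₀).trans ?_
    rw [hcard, ← ENNReal.rpow_mul, two_rpow_add, two_rpow_add, mul_assoc]
    gcongr
  have hu₁ : besovNorm ψ s₁ p₁ q₁ (U S α β) ≤ 2 ^ (t₁ + (e₁ + ν * recip q₁)) := by
    refine (h₁ S α β e₁ hS hβ he₁).trans ?_
    rw [hcard, ← ENNReal.rpow_mul, two_rpow_add, two_rpow_add, mul_assoc]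
    gcongr
  have hmain := hC (U S α β) ⟨hu₀.trans_lt (two_rpow_ne_top _).lt_top,
    hu₁.trans_lt (two_rpow_ne_top _).lt_top⟩
  have hl := h S α β e hne hS hβ he
  rw [hcard, hb, ← ENNReal.rpow_mul, ← two_rpow_add, ← two_rpow_add] at hl
  have hfin : (2 : ℝ≥0∞) ^ (b + e + ν * recip q) ≤
      2 ^ (t + (t₀ + (e₀ + ν * recip q₀)) * (1 - θ) + (t₁ + (e₁ + ν * recip q₁)) * θ) := by
    refine hl.trans (hmain.trans ?_)
    rw [two_rpow_add, two_rpow_add, ENNReal.rpow_mul, ENNReal.rpow_mul]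
    gcongr
  have := le_of_two_rpow_le hfin
  linarith

lemma nonpos_of_forall_nat_mul_le {X K : ℝ} (h : ∀ m : ℕ, m * X ≤ K) : X ≤ 0 := by
  by_contra! hX
  obtain ⟨m, hm⟩ := exists_nat_gt (K / X)
  rw [div_lt_iff₀ hX] at hm
  linarith [h m]

/-- The summability exponents have to be compatible if the norms of the packets can be balanced. -/
lemma recip_le_of_balanced {L : ℕ} {K : ℝ}
    (h : ∀ (S : Finset ℤ) (α β : ℤ → ℝ) (e e₀ e₁ : ℝ), S.Nonempty →
      (∀ k ∈ S, ∀ l ∈ S, k ≠ l → (L : ℤ) < |k - l|) → (∀ k ∈ S, β k ≤ k) →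
      (∀ k ∈ S, k * s₀ + α k - β k * (n * recip p₀) ≤ e₀) →
      (∀ k ∈ S, k * s₁ + α k - β k * (n * recip p₁) ≤ e₁) →
      (∀ k ∈ S, e ≤ k * s + α k - β k * (n * recip p)) →
      e + Real.logb 2 S.card * recip q ≤
        K + (1 - θ) * (e₀ + Real.logb 2 S.card * recip q₀) +
          θ * (e₁ + Real.logb 2 S.card * recip q₁))
    {ε : ℤ} (hε : ε = 1 ∨ ε = -1) (α β : ℤ → ℝ) (hβ : ∀ k : ℤ, 0 ≤ ε * k → β k ≤ k)
    (h₀ : θ ≠ 1 → ∀ k : ℤ, k * s₀ + α k - β k * (n * recip p₀) = 0)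
    (h₁ : θ ≠ 0 → ∀ k : ℤ, k * s₁ + α k - β k * (n * recip p₁) = 0)
    (he : ∀ k : ℤ, k * s + α k - β k * (n * recip p) = 0) :
    recip q ≤ (1 - θ) * recip q₀ + θ * recip q₁ := by
  have hε0 : ε ≠ 0 := by rcases hε with rfl | rfl <;> norm_num
  have hεε : ε * ε = 1 := by rcases hε with rfl | rfl <;> norm_num
  have hεa : |ε| = 1 := by rcases hε with rfl | rfl <;> norm_num
  have hL : (L : ℤ) + 1 ≠ 0 := by positivity
  rw [← sub_nonpos]
  refine nonpos_of_forall_nat_mul_le (K := K) fun m => ?_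
  have hinj : Function.Injective fun i : ℕ => ε * ((L + 1) * (i : ℤ)) := fun i j hij => by
    have := mul_left_cancel₀ hL (mul_left_cancel₀ hε0 hij)
    exact_mod_cast this
  -- Multiples of `L + 1` are separated by more than `L`; the sign `ε` selects the half-line on
  -- which `β k ≤ k`. The cardinality `2 ^ m` has logarithm `m`.
  set S : Finset ℤ := (Finset.range (2 ^ m)).map ⟨_, hinj⟩ with hS
  have hcard : Real.logb 2 (S.card : ℝ) = m := by
    rw [hS, Finset.card_map, Finset.card_range]
    push_cast
    rw [← Real.rpow_natCast, Real.logb_rpow (by norm_num) (by norm_num)]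
  have hne : S.Nonempty := by
    rw [hS, Finset.map_nonempty, Finset.nonempty_range_iff]; positivity
  have hsep : ∀ k ∈ S, ∀ l ∈ S, k ≠ l → (L : ℤ) < |k - l| := by
    intro k hk l hl hkl
    obtain ⟨i, -, rfl⟩ := Finset.mem_map.1 hk
    obtain ⟨j, -, rfl⟩ := Finset.mem_map.1 hl
    simp only [Function.Embedding.coeFn_mk] at hkl ⊢
    have hij : (i : ℤ) ≠ j := by rintro hij; exact hkl (by rw [hij])
    rw [← mul_sub, ← mul_sub, abs_mul, abs_mul, hεa, one_mul, abs_of_pos (by positivity)]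
    have : 1 ≤ |(i : ℤ) - j| := Int.one_le_abs (sub_ne_zero.2 hij)
    nlinarith [(Nat.cast_nonneg L : (0 : ℤ) ≤ L)]
  have hSβ : ∀ k ∈ S, β k ≤ k := by
    intro k hk
    obtain ⟨i, -, rfl⟩ := Finset.mem_map.1 hk
    refine hβ _ ?_
    simp only [Function.Embedding.coeFn_mk]
    rw [← mul_assoc, hεε, one_mul]; positivity
  have hbd : ∀ f : ℤ → ℝ, ∃ M, ∀ k ∈ S, f k ≤ M := fun f => by
    obtain ⟨M, hM⟩ := (S.image f).exists_le
    exact ⟨M, fun k hk => hM _ (Finset.mem_image_of_mem f hk)⟩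
  -- If `θ = 1`, the first norm enters with power `0`, so it need not be balanced and any finite
  -- bound will do.
  obtain ⟨e₀, he₀, hz₀⟩ : ∃ e₀, (∀ k ∈ S, k * s₀ + α k - β k * (n * recip p₀) ≤ e₀) ∧
      (1 - θ) * e₀ = 0 := by
    by_cases hθ : θ = 1
    · obtain ⟨M, hM⟩ := hbd fun k => k * s₀ + α k - β k * (n * recip p₀)
      exact ⟨M, hM, by simp [hθ]⟩
    · exact ⟨0, fun k _ => (h₀ hθ k).le, mul_zero _⟩
  obtain ⟨e₁, he₁, hz₁⟩ : ∃ e₁, (∀ k ∈ S, k * s₁ + α k - β k * (n * recip p₁) ≤ e₁) ∧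
      θ * e₁ = 0 := by
    by_cases hθ : θ = 0
    · obtain ⟨M, hM⟩ := hbd fun k => k * s₁ + α k - β k * (n * recip p₁)
      exact ⟨M, hM, by simp [hθ]⟩
    · exact ⟨0, fun k _ => (h₁ hθ k).le, mul_zero _⟩
  have := h S α β 0 e₀ e₁ hne hsep hSβ he₀ he₁ fun k _ => (he k).ge
  rw [hcard] at this
  linarith

theorem conditions_of_exists_besovNorm_le (hn : 1 ≤ n) (hψ : IsCutoff ψ) (hp : 0 < p) (hp₀ : 0 < p₀)
    (hp₁ : 0 < p₁) (hq : 0 < q) (hq₀ : 0 < q₀) (hq₁ : 0 < q₁) (hθ₀ : 0 ≤ θ) (hθ₁ : θ ≤ 1)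
    (h : ∃ C : ℝ≥0, ∀ u ∈ besovSpace ψ s₀ p₀ q₀ ∩ besovSpace ψ s₁ p₁ q₁,
      besovNorm ψ s p q u ≤
        C * besovNorm ψ s₀ p₀ q₀ u ^ (1 - θ) * besovNorm ψ s₁ p₁ q₁ u ^ θ) :
    ((n : ℝ) * recip p - s =
      (1 - θ) * ((n : ℝ) * recip p₀ - s₀) + θ * ((n : ℝ) * recip p₁ - s₁)) ∧
    (s ≤ (1 - θ) * s₀ + θ * s₁) ∧
    (p₀ ≠ p₁ ∧ s = (1 - θ) * s₀ + θ * s₁ → recip q ≤ (1 - θ) * recip q₀ + θ * recip q₁) ∧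
    (p₀ = p₁ ∧ s = (1 - θ) * s₀ + θ * s₁ →
      ((0 < θ ∧ θ < 1) ∧ s₀ ≠ s₁) ∨ recip q ≤ (1 - θ) * recip q₀ + θ * recip q₁) ∧
    (s < (1 - θ) * s₀ + θ * s₁ →
      ((0 < θ ∧ θ < 1) ∧ s₀ - (n : ℝ) * recip p₀ ≠ s - (n : ℝ) * recip p) ∨
        recip q ≤ (1 - θ) * recip q₀ + θ * recip q₁) := by
  have hn' : (0 : ℝ) < n := by exact_mod_cast hn
  obtain ⟨L, K, hK⟩ := exists_exponent_le hn hψ hp hp₀ hp₁ hq hq₀ hq₁ hθ₀ hθ₁ h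
  have hscale : (n : ℝ) * recip p - s =
      (1 - θ) * ((n : ℝ) * recip p₀ - s₀) + θ * ((n : ℝ) * recip p₁ - s₁) := by
    have hk : ∀ k : ℤ, (k : ℝ) * ((1 - θ) * ((n : ℝ) * recip p₀ - s₀) +
        θ * ((n : ℝ) * recip p₁ - s₁) - ((n : ℝ) * recip p - s)) ≤ K := fun k => by
      -- A packet whose width is its wavelength: all three norms scale by homogeneity, and both
      -- signs of `k` give the equality.
      have := hK {k} (fun _ => 0) (fun k => k) (k * s - k * (n * recip p))
        (k * s₀ - k * (n * recip p₀)) (k * s₁ - k * (n * recip p₁)) (by simp) (by simp) (by simp)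
        (by simp) (by simp) (by simp)
      simp at this
      linarith
    have h1 := nonpos_of_forall_nat_mul_le (fun m : ℕ => by simpa using hk m)
    have h2 := nonpos_of_forall_nat_mul_le (K := K)
      (X := -((1 - θ) * ((n : ℝ) * recip p₀ - s₀) +
        θ * ((n : ℝ) * recip p₁ - s₁) - ((n : ℝ) * recip p - s)))
      (fun m : ℕ => by have := hk (-m); push_cast at this; linarith)
    linarith
  have hs : s ≤ (1 - θ) * s₀ + θ * s₁ := by
    have := nonpos_of_forall_nat_mul_le (K := K)
      (X := n * recip p - (1 - θ) * (n * recip p₀) - θ * (n * recip p₁)) fun m => by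
      -- A packet of fixed frequency and width `2 ^ m` sees only integrability; with the scaling
      -- identity the resulting inequality is the one for `s`.
      have := hK {0} (fun _ => 0) (fun _ => -(m : ℝ)) (m * (n * recip p)) (m * (n * recip p₀))
        (m * (n * recip p₁)) (by simp) (by simp) (by simp) (by simp) (by simp) (by simp)
      simp at this
      linarith
    linarith
  -- In these cases every norm that enters with a positive power has the same homogeneity as the
  -- left side, so packets with `β = k` are balanced by one choice of amplitude.
  have hedge : θ = 0 ∨ θ = 1 ∨ s₀ - (n : ℝ) * recip p₀ = s - (n : ℝ) * recip p →
      recip q ≤ (1 - θ) * recip q₀ + θ * recip q₁ := by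
    intro hc
    have h₀ : θ ≠ 1 → s₀ - (n : ℝ) * recip p₀ = s - (n : ℝ) * recip p := by
      intro h1
      rcases hc with rfl | hc | hc
      · linarith
      · exact absurd hc h1
      · exact hc
    have h₁ : θ ≠ 0 → s₁ - (n : ℝ) * recip p₁ = s - (n : ℝ) * recip p := by
      intro h0
      by_cases h1 : θ = 1
      · subst h1; linarith
      · refine mul_left_cancel₀ h0 ?_
        linear_combination hscale - (1 - θ) * h₀ h1
    refine recip_le_of_balanced hK (Or.inl rfl) (fun k => -(k * (s - (n : ℝ) * recip p)))
      (fun k => k) (fun k _ => le_rfl) (fun h k => ?_) (fun h k => ?_) (fun k => by ring)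
    · linear_combination (k : ℝ) * h₀ h
    · linear_combination (k : ℝ) * h₁ h
  refine ⟨hscale, hs, ?_, ?_, ?_⟩
  · rintro ⟨hne, hseq⟩
    by_cases hc : θ = 0 ∨ θ = 1
    · exact hedge (hc.imp_right Or.inl)
    have hr : (n : ℝ) * (recip p₀ - recip p₁) ≠ 0 :=
      mul_ne_zero hn'.ne' (sub_ne_zero.2 fun h => hne (recip_injective hp₀ hp₁ h))
    -- With widths `2 ^ (-σ k)` the difference `k (s₀ - s₁)` between the weights is compensated by
    -- the different dependence of the two `L^p` norms on the width; this needs `p₀ ≠ p₁`. The third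
    -- norm is then balanced by the scaling identity and the equality for `s`.
    obtain ⟨σ, hσ⟩ : ∃ σ : ℝ, σ * ((n : ℝ) * (recip p₀ - recip p₁)) = s₀ - s₁ :=
      ⟨(s₀ - s₁) / ((n : ℝ) * (recip p₀ - recip p₁)), div_mul_cancel₀ _ hr⟩
    have h₀ : ∀ k : ℤ, (k : ℝ) * s₀ + (-(k * s₀) + σ * k * (n * recip p₀)) -
        σ * k * (n * recip p₀) = 0 := fun k => by ring
    have h₁ : ∀ k : ℤ, (k : ℝ) * s₁ + (-(k * s₀) + σ * k * (n * recip p₀)) -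
        σ * k * (n * recip p₁) = 0 := fun k => by linear_combination (k : ℝ) * hσ
    have he : ∀ k : ℤ, (k : ℝ) * s + (-(k * s₀) + σ * k * (n * recip p₀)) -
        σ * k * (n * recip p) = 0 := fun k => by
      linear_combination (k : ℝ) * θ * hσ + (k : ℝ) * (1 - σ) * hseq - σ * k * hscale
    -- The constraint `σ k ≤ k` holds for `k ≥ 0` if `σ ≤ 1` and for `k ≤ 0` if `σ ≥ 1`.
    rcases le_total σ 1 with h1 | h1
    · refine recip_le_of_balanced hK (Or.inl rfl) _ (fun k => σ * k) (fun k hk => ?_)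
        (fun _ => h₀) (fun _ => h₁) he
      have : (0 : ℝ) ≤ k := by exact_mod_cast (by simpa using hk : (0 : ℤ) ≤ k)
      nlinarith
    · refine recip_le_of_balanced hK (Or.inr rfl) _ (fun k => σ * k) (fun k hk => ?_)
        (fun _ => h₀) (fun _ => h₁) he
      have : (k : ℝ) ≤ 0 := by exact_mod_cast (by linarith : k ≤ (0 : ℤ))
      nlinarith
  · rintro ⟨rfl, hseq⟩
    by_cases hc : (0 < θ ∧ θ < 1) ∧ s₀ ≠ s₁
    · exact Or.inl hc
    refine Or.inr (hedge ?_)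
    by_contra! hne
    refine hc ⟨⟨lt_of_le_of_ne hθ₀ (Ne.symm hne.1), lt_of_le_of_ne hθ₁ hne.2.1⟩, ?_⟩
    rintro rfl
    exact hne.2.2 (by linarith)
  · intro _
    by_cases hc : (0 < θ ∧ θ < 1) ∧ s₀ - (n : ℝ) * recip p₀ ≠ s - (n : ℝ) * recip p
    · exact Or.inl hc
    refine Or.inr (hedge ?_)
    by_contra! hne
    exact hc ⟨⟨lt_of_le_of_ne hθ₀ (Ne.symm hne.1), lt_of_le_of_ne hθ₁ hne.2.1⟩, hne.2.2⟩

end Necessity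

end HomBesov

theorem theorem1p2 (n : ℕ) (hn : 1 ≤ n)
    (ψ : EuclideanSpace ℝ (Fin n) → ℝ) (hψ : HomBesov.IsCutoff ψ)
    (p p₀ p₁ q q₀ q₁ : ℝ≥0∞)
    (hp : 0 < p) (hp₀ : 0 < p₀) (hp₁ : 0 < p₁) (hq : 0 < q) (hq₀ : 0 < q₀) (hq₁ : 0 < q₁)
    (s s₀ s₁ θ : ℝ) (hθ₀ : 0 ≤ θ) (hθ₁ : θ ≤ 1) :
    (∃ C : ℝ≥0, ∀ u : 𝓢'(EuclideanSpace ℝ (Fin n), ℂ),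
        u ∈ HomBesov.besovSpace ψ s₀ p₀ q₀ ∩ HomBesov.besovSpace ψ s₁ p₁ q₁ →
          HomBesov.besovNorm ψ s p q u ≤
            C * HomBesov.besovNorm ψ s₀ p₀ q₀ u ^ (1 - θ) *
              HomBesov.besovNorm ψ s₁ p₁ q₁ u ^ θ) ↔
      ((n : ℝ) * HomBesov.recip p - s =
          (1 - θ) * ((n : ℝ) * HomBesov.recip p₀ - s₀) +
            θ * ((n : ℝ) * HomBesov.recip p₁ - s₁)) ∧
      (s ≤ (1 - θ) * s₀ + θ * s₁) ∧
      (p₀ ≠ p₁ ∧ s = (1 - θ) * s₀ + θ * s₁ →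
          HomBesov.recip q ≤ (1 - θ) * HomBesov.recip q₀ + θ * HomBesov.recip q₁) ∧
      (p₀ = p₁ ∧ s = (1 - θ) * s₀ + θ * s₁ →
          ((0 < θ ∧ θ < 1) ∧ s₀ ≠ s₁) ∨
          HomBesov.recip q ≤ (1 - θ) * HomBesov.recip q₀ + θ * HomBesov.recip q₁) ∧
      (s < (1 - θ) * s₀ + θ * s₁ →
          ((0 < θ ∧ θ < 1) ∧
            s₀ - (n : ℝ) * HomBesov.recip p₀ ≠ s - (n : ℝ) * HomBesov.recip p) ∨
          HomBesov.recip q ≤ (1 - θ) * HomBesov.recip q₀ + θ * HomBesov.recip q₁) := by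
  constructor
  · exact HomBesov.conditions_of_exists_besovNorm_le hn hψ hp hp₀ hp₁ hq hq₀ hq₁ hθ₀ hθ₁
  · rintro ⟨hscale, hs, hne, heq, hlt⟩
    exact HomBesov.exists_besovNorm_le hn hψ hp hp₀ hp₁ hq hq₀ hq₁ hθ₀ hθ₁ hscale hs hne heq hlt
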